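/- Let $m\ge 2$, let $M$ be a smooth $m$-dimensional manifold, and let $f:M\to\mathbb{R}^{m+1}$ be a locally strongly convex hypersurface with Blaschke normal vector field $\xi$. That is, $f$ is a smooth immersion, $\xi:M\to\mathbb{R}^{m+1}$ is smooth, $\mathbb{R}^{m+1}=df(T_xM)\oplus\mathbb{R}\xi_x$ for every $x\in M$, and, with $D$ the standard flat connection and $\nabla,h,S,\theta$ defined by $$D_Xf_*Y=f_*\nabla_XY+h(X,Y)\xi,\qquad D_X\xi=-f_*SX+\theta(X)\xi,$$ one has $\theta=0$, $h$ is positive definite, and $|\det(f_*X_1,\dots,f_*X_m,\xi)|=\sqrt{\det(h(X_i,X_j))}$ for all tangent vectors $X_1,\dots,X_m$ at any point of $M$. For a smooth map $u:(M,g,\nabla^M)\to(N,g^N,\nabla^N)$ between statistical manifolds (a Riemannian metric $g$ with a torsion-free connection $\nabla$ such that $(\nabla_Xg)(Y,Z)=(\nabla_Yg)(X,Z)$), put $$\tau(u)=\mathrm{tr}_g\{(X,Y)\mapsto\nabla^N_Xu_*Y-u_*\nabla^M_XY\},$$ $$\tau_2(u)=\bar\Delta^u\tau(u)+\mathrm{div}^g(\mathrm{tr}_gK^M)\,\tau(u)-\sum_iL^N(u_*e_i,\tau(u))u_*e_i-K^N(\tau(u),\tau(u)),$$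 where $(e_i)$ is a $g$-orthonormal basis, $K=\nabla-\nabla^g$ with $\nabla^g$ the Levi-Civita connection, $\mathrm{div}^gZ=\mathrm{tr}\,\nabla^gZ$, $L$ is given by $g(L(Z,W)X,Y)=g(R^\nabla(X,Y)Z,W)$ with $R^\nabla$ the curvature of $\nabla$, and $\bar\Delta^uU=\mathrm{tr}_g\{(X,Y)\mapsto\overline\nabla^N_X\overline\nabla^N_YU-\overline\nabla^N_{\overline\nabla^M_XY}U\}$ for sections $U$ of $u^{-1}TN$, with $\overline\nabla$ the conjugate connection: $Xg(Y,Z)=g(\nabla_XY,Z)+g(Y,\overline\nabla_XZ)$. The map $u$ is called statistical biharmonic if $\tau_2(u)=0$ on $M$. Then $(h,\nabla)$ is a statistical structure on $M$. Consider $f$ as a map from $(M,h,\nabla)$ to $(\mathbb{R}^{m+1},g_0,D)$, where $g_0$ is the Euclidean metric. Then $\tau(f)=m\xi$, and $\tau(f)$ vanishes nowhere. Moreover, $f$ is statistical biharmonic if and only if $\mathrm{tr}\,S=0$ and $\mathrm{tr}_h\nabla S=0$ on $M$, where $\mathrm{tr}_h\nabla S=\mathrm{tr}_h\{(X,Y)\mapsto(\nabla_XS)Y\}$.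 In particular, if $f$ is an improper affine hypersphere ($S=0$), then $f$ is statistical biharmonic. -/

import Mathlib

open scoped Manifold ContDiff
open Bundle

noncomputable section StatisticalGeometry

variable {E : Type*} [NormedAddCommGroup E] [NormedSpace ℝ E] [FiniteDimensional ℝ E]
  {H : Type*} [TopologicalSpace H] (I : ModelWithCorners ℝ E H)
  {M : Type*} [TopologicalSpace M] [ChartedSpace H M] [IsManifold I ∞ M]
  {E' : Type*} [NormedAddCommGroup E'] [NormedSpace ℝ E'] [FiniteDimensional ℝ E']
  {H' : Type*} [TopologicalSpace H'] (J : ModelWithCorners ℝ E' H')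
  {N : Type*} [TopologicalSpace N] [ChartedSpace H' N] [IsManifold J ∞ N]

/-! ### Vector fields, connections, metrics, traces

A bilinear form on the tangent spaces of `M` is a family `g x : T_xM → T_xM → ℝ`.  A connection on
a vector bundle `V` over `M` is, as in Mathlib, a map `cov` taking a section `σ` to a section of
`Hom(TM, V)`: the value `cov σ x v` is `∇_v σ` at the point `x`, for `v ∈ T_xM`. -/

/-- Bilinear forms on the tangent spaces of `M`. -/
abbrev TangentForm (M : Type*) [TopologicalSpace M] [ChartedSpace H M] : Type _ :=
  (x : M) → TangentSpace I x → TangentSpace I x → ℝ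

/-- Operators with the type of an affine connection on `M` (the laws of a connection are
`IsCovariantDerivativeOn`). -/
abbrev AffineConn (M : Type*) [TopologicalSpace M] [ChartedSpace H M] : Type _ :=
  ((x : M) → TangentSpace I x) → (x : M) → TangentSpace I x →L[ℝ] TangentSpace I x

/-- A basis of the tangent space `T_xM`. -/
def tangentBasis (x : M) :
    Module.Basis (Fin (Module.finrank ℝ E)) ℝ (TangentSpace I x) :=
  (Module.finBasis ℝ E : Module.Basis (Fin (Module.finrank ℝ E)) ℝ E)

variable {I} in
/-- A smooth vector field near `x` with value `v` at `x`. -/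
def extendVec {x : M} (v : TangentSpace I x) : (y : M) → TangentSpace I y :=
  FiberBundle.extend E v

variable {I} in
/-- The linear map on `T_xM` that takes the same values as `F` on a basis; it is `F` itself when
`F` is linear. -/
def linearize {x : M} {W : Type*} [AddCommGroup W] [Module ℝ W] [TopologicalSpace W]
    [IsTopologicalAddGroup W] [ContinuousSMul ℝ W] (F : TangentSpace I x → W) :
    TangentSpace I x →L[ℝ] W :=
  haveI : FiniteDimensional ℝ (TangentSpace I x) := inferInstanceAs (FiniteDimensional ℝ E)
  haveI : T2Space (TangentSpace I x) := inferInstanceAs (T2Space E)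
  LinearMap.toContinuousLinearMap
    ((tangentBasis I x).constr ℝ fun i => F (tangentBasis I x i))

variable {I} in
/-- The trace `tr_g B = ∑ g^{ij} B(b_i, b_j)` of a bilinear map `B` on `T_xM` with respect to an
inner product `g` on `T_xM`; equivalently `∑ B(e_i, e_i)` over a `g`-orthonormal basis. -/
def metricTrace {x : M} (g : TangentSpace I x → TangentSpace I x → ℝ)
    {W : Type*} [AddCommGroup W] [Module ℝ W]
    (B : TangentSpace I x → TangentSpace I x → W) : W :=
  ∑ i, ∑ j, (Matrix.of fun k l => g (tangentBasis I x k) (tangentBasis I x l))⁻¹ i j •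
    B (tangentBasis I x i) (tangentBasis I x j)

variable {I} in
/-- The vector `Z ∈ T_xM` with `g(Z, w) = φ(w)` for all `w`, for a linear form `φ` on `T_xM`. -/
def metricSharp {x : M} (g : TangentSpace I x → TangentSpace I x → ℝ)
    (φ : TangentSpace I x → ℝ) : TangentSpace I x :=
  metricTrace g fun v w => φ v • w

variable {I} in
/-- `X(g(Y, Z))` at `x` for `X` with value `v` at `x`. -/
def metricDeriv (g : TangentForm I M) (Y Z : (x : M) → TangentSpace I x) (x : M)
    (v : TangentSpace I x) : ℝ :=
  mvfderiv I (fun y => g y (Y y) (Z y)) x v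

/-- Statistical structures `(g, ∇)`: `g` is a Riemannian metric, `∇` a torsion-free
affine connection with `(∇_X g)(Y, Z) = (∇_Y g)(X, Z)`, everything being smooth. -/
structure IsStatisticalStructure (g : TangentForm I M) (nabla : AffineConn I M) : Prop where
  riemannian : ∃ G : ContMDiffRiemannianMetric I ∞ E (TangentSpace I : M → Type _),
    ∀ x v w, G.inner x v w = g x v w
  connection : IsCovariantDerivativeOn (I := I) E nabla Set.univ
  smooth : ContMDiffCovariantDerivativeOn (I := I) E ∞ nabla Set.univ
  torsion_free : ∀ (x : M) (X Y : (x : M) → TangentSpace I x),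
    MDiffAt (T% X) x → MDiffAt (T% Y) x →
      nabla Y x (X x) - nabla X x (Y x) = VectorField.mlieBracket I X Y x
  codazzi : ∀ (x : M) (X Y Z : (x : M) → TangentSpace I x),
    MDiffAt (T% X) x → MDiffAt (T% Y) x → MDiffAt (T% Z) x →
      metricDeriv g Y Z x (X x) - g x (nabla Y x (X x)) (Z x) - g x (Y x) (nabla Z x (X x)) =
      metricDeriv g X Z x (Y x) - g x (nabla X x (Y x)) (Z x) - g x (X x) (nabla Z x (Y x))

variable {I} in
/-- The Levi-Civita connection of `g`, by the Koszul formula. -/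
def leviCivita (g : TangentForm I M) : AffineConn I M := fun Y x =>
  linearize fun v => metricSharp (g x) fun w =>
    (1 / 2 : ℝ) *
      (metricDeriv g Y (extendVec w) x v
        + metricDeriv g (extendVec v) (extendVec w) x (Y x)
        - metricDeriv g (extendVec v) Y x w
        + g x (VectorField.mlieBracket I (extendVec v) Y x) w
        - g x (VectorField.mlieBracket I (extendVec v) (extendVec w) x) (Y x)
        - g x (VectorField.mlieBracket I Y (extendVec w) x) v)

variable {I} in
/-- The conjugate connection `∇̄`, determined by
`X g(Y, Z) = g(∇_X Y, Z) + g(Y, ∇̄_X Z)`. -/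
def conjugateConn (g : TangentForm I M) (nabla : AffineConn I M) : AffineConn I M := fun Z x =>
  linearize fun v => metricSharp (g x) fun w =>
    metricDeriv g (extendVec w) Z x v - g x (nabla (extendVec w) x v) (Z x)

variable {I} in
/-- The tensor `K(X, Y) = ∇_X Y - ∇^g_X Y`. -/
def differenceTensor (g : TangentForm I M) (nabla : AffineConn I M) (x : M)
    (v w : TangentSpace I x) : TangentSpace I x :=
  nabla (extendVec w) x v - leviCivita g (extendVec w) x v

variable {I} in
/-- The curvature `R(X, Y)Z = ∇_X ∇_Y Z - ∇_Y ∇_X Z - ∇_{[X, Y]} Z`. -/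
def curvature (nabla : AffineConn I M) (x : M) (u v w : TangentSpace I x) : TangentSpace I x :=
  nabla (fun y => nabla (extendVec w) y (extendVec v y)) x u
    - nabla (fun y => nabla (extendVec w) y (extendVec u y)) x v
    - nabla (extendVec w) x (VectorField.mlieBracket I (extendVec u) (extendVec v) x)

variable {I} in
/-- The curvature interchange tensor `L(Z, W)X`, determined by
`g(L(Z, W)X, Y) = g(R(X, Y)Z, W)`. -/
def curvatureInterchange (g : TangentForm I M) (nabla : AffineConn I M) (x : M)
    (z w v : TangentSpace I x) : TangentSpace I x :=
  metricSharp (g x) fun y => g x (curvature nabla x v y z) w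

variable {I} in
/-- The vector field `tr_g K`. -/
def traceK (g : TangentForm I M) (nabla : AffineConn I M) (x : M) : TangentSpace I x :=
  metricTrace (g x) (differenceTensor g nabla x)

variable {I} in
/-- The divergence `div^g Z = tr(∇^g Z)`. -/
def metricDiv (g : TangentForm I M) (Z : (x : M) → TangentSpace I x) (x : M) : ℝ :=
  LinearMap.trace ℝ (TangentSpace I x) (leviCivita g Z x).toLinearMap

variable {I} in
/-- The statistical connection Laplacian of `(g, ∇)` and a connection `covV` on a vector bundle `V`:
`Δ ξ = tr_g {(X, Y) ↦ ∇^V_X ∇^V_Y ξ - ∇^V_{∇_X Y} ξ}`. -/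
def statLaplacian (g : TangentForm I M) (nabla : AffineConn I M)
    {V : M → Type*} [∀ x, AddCommGroup (V x)] [∀ x, Module ℝ (V x)] [∀ x, TopologicalSpace (V x)]
    (covV : ((x : M) → V x) → (x : M) → TangentSpace I x →L[ℝ] V x)
    (s : (x : M) → V x) (x : M) : V x :=
  metricTrace (g x) fun v w =>
    covV (fun y => covV s y (extendVec w y)) x v - covV s x (nabla (extendVec w) x v)

variable {I J} in
/-- The connection `∇^u` on `u⁻¹TN` induced from `∇^N` by `u : M → N`. In the local frame `(E_a)` of
`TN` given by the trivialization around `u x`, a section is `U = ∑ U^a E_a∘u`, and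
`∇^u_v U = ∑ dU^a(v) E_a + ∇^N_{u_* v} (∑ U^a(x) E_a)`. -/
def pullbackConn (u : M → N) (nablaN : AffineConn J N)
    (U : (x : M) → TangentSpace J (u x)) (x : M) :
    TangentSpace I x →L[ℝ] TangentSpace J (u x) :=
  letI t := trivializationAt E' (TangentSpace J : N → Type _) (u x)
  (t.symmL ℝ (u x)) ∘L mvfderiv I (fun y => t.continuousLinearMapAt ℝ (u y) (U y)) x
    + nablaN (fun q => t.symmL ℝ q (t.continuousLinearMapAt ℝ (u x) (U x))) (u x) ∘L
        mfderiv I J u x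

variable {I J} in
/-- The tension field `τ(u) = tr_g {(X, Y) ↦ ∇^N_X u_*Y - u_* ∇^M_X Y}`. -/
def tension (g : TangentForm I M) (nablaM : AffineConn I M) (nablaN : AffineConn J N)
    (u : M → N) (x : M) : TangentSpace J (u x) :=
  metricTrace (g x) fun v w =>
    pullbackConn u nablaN (fun y => mfderiv I J u y (extendVec w y)) x v
      - mfderiv I J u x (nablaM (extendVec w) x v)

variable {I J} in
/-- The statistical bi-tension field
`τ₂(u) = Δ̄^u τ(u) + div^g(tr_g K^M) τ(u) - ∑ L^N(u_* e_i, τ(u)) u_* e_i - K^N(τ(u), τ(u))`,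
where `Δ̄^u` is the Laplacian of `∇̄^M` and of the conjugate connection on `u⁻¹TN`, which is the
connection induced by `∇̄^N`. -/
def biTension (g : TangentForm I M) (nablaM : AffineConn I M)
    (gN : TangentForm J N) (nablaN : AffineConn J N)
    (u : M → N) (x : M) : TangentSpace J (u x) :=
  statLaplacian (V := fun y => TangentSpace J (u y)) g (conjugateConn g nablaM)
      (pullbackConn u (conjugateConn gN nablaN)) (tension g nablaM nablaN u) x
    + metricDiv g (traceK g nablaM) x • tension g nablaM nablaN u x
    - metricTrace (g x) (fun v w =>
        curvatureInterchange gN nablaN (u x) (mfderiv I J u x v) (tension g nablaM nablaN u x)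
          (mfderiv I J u x w))
    - differenceTensor gN nablaN (u x) (tension g nablaM nablaN u x) (tension g nablaM nablaN u x)

variable {I J} in
/-- `u` is statistical biharmonic if `τ₂(u) = 0`. -/
def IsStatisticalBiharmonic (g : TangentForm I M) (nablaM : AffineConn I M)
    (gN : TangentForm J N) (nablaN : AffineConn J N) (u : M → N) : Prop :=
  ∀ x, biTension g nablaM gN nablaN u x = 0

/-! ### The target: Euclidean space -/

/-- The standard flat connection `D` of `ℝⁿ`. -/
def flatConn (n : ℕ) :
    AffineConn 𝓘(ℝ, EuclideanSpace ℝ (Fin n)) (EuclideanSpace ℝ (Fin n)) :=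
  fun Y x => fderiv ℝ (fun y => (Y y : EuclideanSpace ℝ (Fin n))) x

/-- The Euclidean metric `g₀` of `ℝⁿ`. -/
def euclideanMetric (n : ℕ) :
    TangentForm 𝓘(ℝ, EuclideanSpace ℝ (Fin n)) (EuclideanSpace ℝ (Fin n)) :=
  fun _ v w => inner ℝ (v : EuclideanSpace ℝ (Fin n)) (w : EuclideanSpace ℝ (Fin n))

/-! ### Hypersurfaces with a transversal vector field

For an immersion `f : M → F` into a vector space and a transversal vector field `ξ : M → F`, the
decomposition `F = df(T_xM) ⊕ ℝ ξ_x` defines `∇`, `h`, `S` and `τ` by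
`D_X f_*Y = f_* ∇_X Y + h(X, Y) ξ` and `D_X ξ = -f_* S X + τ(X) ξ`. -/

variable {F : Type*} [NormedAddCommGroup F] [NormedSpace ℝ F]

/-- The linear map `T_xM × ℝ → F`, `(v, t) ↦ df(v) + t ξ_x`. -/
def splitMap (f ξ : M → F) (x : M) : (TangentSpace I x × ℝ) →L[ℝ] F :=
  (mvfderiv I f x).coprod (ContinuousLinearMap.toSpanSingleton ℝ (ξ x))

/-- The component in `T_xM` of a vector in `F = df(T_xM) ⊕ ℝ ξ_x`. -/
def tangentPart (f ξ : M → F) (x : M) : F →L[ℝ] TangentSpace I x :=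
  (ContinuousLinearMap.fst ℝ (TangentSpace I x) ℝ) ∘L (splitMap I f ξ x).inverse

/-- The coefficient of `ξ_x` of a vector in `F = df(T_xM) ⊕ ℝ ξ_x`. -/
def normalPart (f ξ : M → F) (x : M) : F →L[ℝ] ℝ :=
  (ContinuousLinearMap.snd ℝ (TangentSpace I x) ℝ) ∘L (splitMap I f ξ x).inverse

/-- The derivative `D_X (f_* Y)` at `x`, as a linear map in the value of `X` at `x`. -/
def pushDeriv (f : M → F) (Y : (x : M) → TangentSpace I x) (x : M) : TangentSpace I x →L[ℝ] F :=
  mvfderiv I (fun y => mvfderiv I f y (Y y)) x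

/-- The induced connection `∇`. -/
def inducedConn (f ξ : M → F) : AffineConn I M :=
  fun Y x => tangentPart I f ξ x ∘L pushDeriv I f Y x

/-- The affine fundamental form `h`. -/
def affineForm (f ξ : M → F) : TangentForm I M :=
  fun x v w => normalPart I f ξ x (pushDeriv I f (extendVec w) x v)

/-- The affine shape operator `S`. -/
def shapeOperator (f ξ : M → F) (x : M) : TangentSpace I x →L[ℝ] TangentSpace I x :=
  -(tangentPart I f ξ x ∘L mvfderiv I ξ x)

/-- The transversal connection form `τ`. -/
def transversalForm (f ξ : M → F) (x : M) : TangentSpace I x →L[ℝ] ℝ :=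
  normalPart I f ξ x ∘L mvfderiv I ξ x

variable {I} in
/-- The covariant derivative `(∇_X A) Y = ∇_X (A Y) - A (∇_X Y)` of an endomorphism field `A`. -/
def covDerivEnd (nabla : AffineConn I M) (A : (x : M) → TangentSpace I x →L[ℝ] TangentSpace I x)
    (x : M) (v w : TangentSpace I x) : TangentSpace I x :=
  nabla (fun y => A y (extendVec w y)) x v - A x (nabla (extendVec w) x v)

/-- `f : M → ℝ^{m+1}` is a locally strongly convex hypersurface with Blaschke normal vector
field `ξ`. -/
structure IsBlaschkeHypersurface {m : ℕ} {M : Type*} [TopologicalSpace M]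
    [ChartedSpace (EuclideanSpace ℝ (Fin m)) M] [IsManifold (𝓡 m) ∞ M]
    (f ξ : M → EuclideanSpace ℝ (Fin (m + 1))) : Prop where
  smooth : ContMDiff (𝓡 m) 𝓘(ℝ, EuclideanSpace ℝ (Fin (m + 1))) ∞ f
  immersion : ∀ x, Function.Injective (mvfderiv (𝓡 m) f x)
  smooth_normal : ContMDiff (𝓡 m) 𝓘(ℝ, EuclideanSpace ℝ (Fin (m + 1))) ∞ ξ
  transversal : ∀ x, IsCompl (mvfderiv (𝓡 m) f x).range (Submodule.span ℝ {ξ x})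
  equiaffine : ∀ x, transversalForm (𝓡 m) f ξ x = 0
  posDef : ∀ (x : M) (v : TangentSpace (𝓡 m) x), v ≠ 0 → 0 < affineForm (𝓡 m) f ξ x v v
  /-- `det(f_* X_1, …, f_* X_m, ξ)` is, up to the orientation, the Riemannian volume of `h`. -/
  volume : ∀ (x : M) (X : Fin m → TangentSpace (𝓡 m) x),
    |(EuclideanSpace.basisFun (Fin (m + 1)) ℝ).toBasis.det
        (Fin.snoc (α := fun _ => EuclideanSpace ℝ (Fin (m + 1)))
          (fun i => mvfderiv (𝓡 m) f x (X i)) (ξ x))| =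
      Real.sqrt (Matrix.of fun i j => affineForm (𝓡 m) f ξ x (X i) (X j)).det

end StatisticalGeometry

open scoped Topology

set_option linter.unusedSectionVars false

section Immersions

variable {E : Type*} [NormedAddCommGroup E] [NormedSpace ℝ E] [FiniteDimensional ℝ E]
  {H : Type*} [TopologicalSpace H] {I : ModelWithCorners ℝ E H}
  {M : Type*} [TopologicalSpace M] [ChartedSpace H M] [IsManifold I ∞ M]
  {F : Type*} [NormedAddCommGroup F] [NormedSpace ℝ F]

theorem two_le_infty : (2 : ℕ∞ω) ≤ ∞ := ENat.LEInfty.out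

/-! ### Differentials of maps into a vector space along vector fields -/

theorem contMDiffAt_mvfderiv_comp_symmL {f : M → F} {x : M} {n k : ℕ∞ω}
    (hf : ContMDiffAt I 𝓘(ℝ, F) k f x) (hn : n + 1 ≤ k) :
    ContMDiffAt I 𝓘(ℝ, E →L[ℝ] F) n (fun y => mvfderiv I f y ∘L
      (trivializationAt E (TangentSpace I : M → Type _) x).symmL ℝ y) x := by
  refine (hf.mfderiv_const hn).congr_of_eventuallyEq (Filter.Eventually.of_forall fun y => ?_)
  ext v
  simp [inTangentCoordinates, ContinuousLinearMap.inCoordinates, mvfderiv]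
  rfl

theorem mvfderiv_apply_eventuallyEq (f : M → F) (Y : (x : M) → TangentSpace I x) (x : M) :
    (fun y => mvfderiv I f y (Y y)) =ᶠ[𝓝 x] fun y => (mvfderiv I f y ∘L
      (trivializationAt E (TangentSpace I : M → Type _) x).symmL ℝ y)
        (trivializationAt E (TangentSpace I : M → Type _) x ⟨y, Y y⟩).2 := by
  filter_upwards [(trivializationAt E (TangentSpace I : M → Type _) x).open_baseSet.mem_nhds
    (FiberBundle.mem_baseSet_trivializationAt' x)] with y hy
  have h := Trivialization.symmL_continuousLinearMapAt (R := ℝ) _ hy (Y y)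
  rw [Trivialization.continuousLinearMapAt_apply, Trivialization.coe_linearMapAt_of_mem _ hy] at h
  exact congrArg (mvfderiv I f y) h.symm

theorem ContMDiffAt.mvfderiv_apply {f : M → F} {Y : (x : M) → TangentSpace I x} {x : M}
    {n k : ℕ∞ω} (hf : ContMDiffAt I 𝓘(ℝ, F) k f x) (hn : n + 1 ≤ k)
    (hY : ContMDiffAt I (I.prod 𝓘(ℝ, E)) n (fun y => TotalSpace.mk' E y (Y y)) x) :
    ContMDiffAt I 𝓘(ℝ, F) n (fun y => mvfderiv I f y (Y y)) x :=
  ((contMDiffAt_mvfderiv_comp_symmL hf hn).clm_apply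
    ((contMDiffAt_section x).1 hY)).congr_of_eventuallyEq (mvfderiv_apply_eventuallyEq f Y x)

theorem MDifferentiableAt.mvfderiv_apply {f : M → F} {Y : (x : M) → TangentSpace I x} {x : M}
    (hf : ContMDiffAt I 𝓘(ℝ, F) 2 f x) (hY : MDiffAt (T% Y) x) :
    MDifferentiableAt I 𝓘(ℝ, F) (fun y => mvfderiv I f y (Y y)) x :=
  (((contMDiffAt_mvfderiv_comp_symmL (n := 1) hf (by norm_num [one_add_one_eq_two])).mdifferentiableAt
    one_ne_zero).clm_apply ((mdifferentiableAt_section I Y).1 hY)).congr_of_eventuallyEq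
      (mvfderiv_apply_eventuallyEq f Y x)

theorem mvfderiv_add_apply {f g : M → F} {x : M} (hf : MDiffAt f x) (hg : MDiffAt g x)
    (v : TangentSpace I x) :
    mvfderiv I (fun y => f y + g y) x v = mvfderiv I f x v + mvfderiv I g x v := by
  rw [show (fun y => f y + g y) = f + g from rfl, mvfderiv_add hf hg]; rfl

theorem Filter.EventuallyEq.mvfderiv_eq {f g : M → F} {x : M} (h : f =ᶠ[𝓝 x] g) :
    mvfderiv I f x = mvfderiv I g x := by
  ext v
  exact congrArg (fun L : E →L[ℝ] F => L v) h.mfderiv_eq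

theorem mvfderiv_smul_apply {a : M → ℝ} {g : M → F} {x : M} (ha : MDiffAt a x) (hg : MDiffAt g x)
    (v : TangentSpace I x) :
    mvfderiv I (fun y => a y • g y) x v = a x • mvfderiv I g x v + mvfderiv I a x v • g x := by
  rw [show (fun y => a y • g y) = a • g from rfl, mvfderiv_smul ha hg]; rfl

theorem pushDeriv_add {f : M → F} {Y Z : (x : M) → TangentSpace I x} {x : M}
    (hf : ContMDiffAt I 𝓘(ℝ, F) 2 f x) (hY : MDiffAt (T% Y) x) (hZ : MDiffAt (T% Z) x) :
    pushDeriv I f (Y + Z) x = pushDeriv I f Y x + pushDeriv I f Z x := by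
  ext v
  simp only [pushDeriv, Pi.add_apply, map_add]
  exact mvfderiv_add_apply (hY.mvfderiv_apply hf) (hZ.mvfderiv_apply hf) v

theorem pushDeriv_smul {f : M → F} {a : M → ℝ} {Y : (x : M) → TangentSpace I x} {x : M}
    (hf : ContMDiffAt I 𝓘(ℝ, F) 2 f x) (ha : MDiffAt a x) (hY : MDiffAt (T% Y) x) :
    pushDeriv I f (a • Y) x =
      a x • pushDeriv I f Y x + (mvfderiv I a x).smulRight (mvfderiv I f x (Y x)) := by
  ext v
  simp only [pushDeriv, Pi.smul_apply', map_smul]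
  exact mvfderiv_smul_apply ha (hY.mvfderiv_apply hf) v

/-! ### Coordinate vector fields -/

theorem extendVec_self {x : M} (v : TangentSpace I x) : extendVec v x = v :=
  FiberBundle.extend_apply_self (F := E) (E := (TangentSpace I : M → Type _)) v

theorem mdifferentiableAt_extendVec {x : M} (v : TangentSpace I x) :
    MDiffAt (T% (extendVec v)) x :=
  FiberBundle.mdifferentiableAt_extend ..

theorem contMDiffAt_extendVec {x : M} (v : TangentSpace I x) :
    ContMDiffAt I (I.prod 𝓘(ℝ, E)) ∞ (fun y => TotalSpace.mk' E y (extendVec v y)) x :=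
  FiberBundle.contMDiffAt_extend ..

theorem eventually_mdifferentiableAt_extendVec {x : M} (v : TangentSpace I x) :
    ∀ᶠ y in 𝓝 x, MDiffAt (T% (extendVec v)) y := by
  obtain ⟨s, hs, h⟩ := FiberBundle.exists_mdifferentiableOn_extend I E v
  filter_upwards [eventually_mem_nhds_iff.2 hs] with y hy
  exact (h y (mem_of_mem_nhds hy)).mdifferentiableAt hy

theorem mdifferentiableAt_symmL {x y : M} (hy : y ∈ (chartAt H x).source) (e : E) :
    MDiffAt (T% (fun z =>
      (trivializationAt E (TangentSpace I : M → Type _) x).symmL ℝ z e)) y := by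
  rw [(trivializationAt E (TangentSpace I : M → Type _) x).mdifferentiableAt_section_iff I _ hy]
  refine (mdifferentiableAt_const (c := e)).congr_of_eventuallyEq ?_
  filter_upwards [(chartAt H x).open_source.mem_nhds hy] with z hz
  have h := Trivialization.continuousLinearMapAt_symmL (R := ℝ)
    (trivializationAt E (TangentSpace I : M → Type _) x) hz e
  rwa [Trivialization.continuousLinearMapAt_apply, Trivialization.coe_linearMapAt_of_mem _ hz] at h

theorem extendVec_eq_symmL {x y : M} (v : TangentSpace I x) (hy : y ∈ (chartAt H x).source) :
    extendVec v y = (trivializationAt E (TangentSpace I : M → Type _) x).symmL ℝ y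
      ((trivializationAt E (TangentSpace I : M → Type _) x).continuousLinearMapAt ℝ x v) := by
  rw [Trivialization.continuousLinearMapAt_apply, extendVec, FiberBundle.extend,
    Trivialization.coe_linearMapAt_of_mem _ (FiberBundle.mem_baseSet_trivializationAt' x),
    Trivialization.symmL_apply _ hy]

theorem extendVec_eventuallyEq {x : M} (v : TangentSpace I x) :
    ∀ᶠ y in 𝓝 x, extendVec v y =
      (trivializationAt E (TangentSpace I : M → Type _) x).symmL ℝ y
        ((trivializationAt E (TangentSpace I : M → Type _) x).continuousLinearMapAt ℝ x v) := by
  filter_upwards [(chartAt H x).open_source.mem_nhds (mem_chart_source H x)] with y hy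
    using extendVec_eq_symmL v hy

variable [I.Boundaryless]

theorem mvfderiv_symmL {f : M → F} {x y : M} (hy : y ∈ (chartAt H x).source)
    (hf : MDifferentiableAt I 𝓘(ℝ, F) f y) (e : E) :
    mvfderiv I f y ((trivializationAt E (TangentSpace I : M → Type _) x).symmL ℝ y e) =
      fderiv ℝ (f ∘ (extChartAt I x).symm) (extChartAt I x y) e := by
  have hy' : y ∈ (extChartAt I x).source := by simpa using hy
  have hsymm : MDifferentiableAt 𝓘(ℝ, E) I (extChartAt I x).symm (extChartAt I x y) := by
    rw [← mdifferentiableWithinAt_univ, ← I.range_eq_univ]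
    exact mdifferentiableWithinAt_extChartAt_symm ((extChartAt I x).map_source hy')
  have hf' : MDifferentiableAt I 𝓘(ℝ, F) f ((extChartAt I x).symm (extChartAt I x y)) := by
    rwa [(extChartAt I x).left_inv hy']
  rw [TangentBundle.symmL_trivializationAt hy, I.range_eq_univ, mfderivWithin_univ]
  have key := mfderiv_comp (I := 𝓘(ℝ, E)) (I' := I) (I'' := 𝓘(ℝ, F)) (extChartAt I x y) hf' hsymm
  rw [mfderiv_eq_fderiv] at key
  rw [key, (extChartAt I x).left_inv hy']
  rfl

theorem contDiffAt_comp_extChartAt_symm {f : M → F} {x y : M} {n : ℕ∞ω} (hn : n ≤ ∞)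
    (hy : y ∈ (chartAt H x).source) (hf : ContMDiffAt I 𝓘(ℝ, F) n f y) :
    ContDiffAt ℝ n (f ∘ (extChartAt I x).symm) (extChartAt I x y) := by
  have hy' : y ∈ (extChartAt I x).source := by simpa using hy
  rw [← contMDiffAt_iff_contDiffAt]
  refine ContMDiffAt.comp (I' := I) _ ?_ ?_
  · rwa [(extChartAt I x).left_inv hy']
  · rw [← contMDiffWithinAt_univ, ← I.range_eq_univ]
    exact (contMDiffWithinAt_extChartAt_symm_range x
      ((extChartAt I x).map_source hy')).of_le hn

/-- In the chart at `x`, the second derivative of `f` gives the derivatives of `f` along pairs of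
coordinate fields. -/
theorem pushDeriv_symmL {f : M → F} {x y : M} (hy : y ∈ (chartAt H x).source)
    (hf : ContMDiffAt I 𝓘(ℝ, F) 2 f y) (e e' : E) :
    pushDeriv I f
        (fun z => (trivializationAt E (TangentSpace I : M → Type _) x).symmL ℝ z e') y
        ((trivializationAt E (TangentSpace I : M → Type _) x).symmL ℝ y e) =
      fderiv ℝ (fderiv ℝ (f ∘ (extChartAt I x).symm)) (extChartAt I x y) e e' := by
  have hy' : y ∈ (extChartAt I x).source := by simpa using hy
  have hev : (fun z => mvfderiv I f z
      ((trivializationAt E (TangentSpace I : M → Type _) x).symmL ℝ z e')) =ᶠ[𝓝 y]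
      fun z => fderiv ℝ (f ∘ (extChartAt I x).symm) (extChartAt I x z) e' := by
    filter_upwards [(chartAt H x).open_source.mem_nhds hy,
      (contMDiffAt_iff_contMDiffAt_nhds (by decide)).1 hf] with z hz hfz
    exact mvfderiv_symmL hz (hfz.mdifferentiableAt two_ne_zero) e'
  have hd : DifferentiableAt ℝ (fderiv ℝ (f ∘ (extChartAt I x).symm)) (extChartAt I x y) :=
    ((contDiffAt_comp_extChartAt_symm two_le_infty hy hf).fderiv_right (m := 1)
      (by norm_num [one_add_one_eq_two])).differentiableAt one_ne_zero
  have hd' : DifferentiableAt ℝ (fun z => fderiv ℝ (f ∘ (extChartAt I x).symm) z e')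
      (extChartAt I x y) := hd.clm_apply (differentiableAt_const e')
  rw [pushDeriv, hev.mvfderiv_eq, mvfderiv_symmL hy]
  · have : ((fun z => fderiv ℝ (f ∘ (extChartAt I x).symm) (extChartAt I x z) e') ∘
        (extChartAt I x).symm) =ᶠ[𝓝 (extChartAt I x y)]
        fun z => fderiv ℝ (f ∘ (extChartAt I x).symm) z e' := by
      filter_upwards [extChartAt_target_mem_nhds' ((extChartAt I x).map_source hy')] with z hz
      rw [Function.comp_apply, (extChartAt I x).right_inv hz]
    rw [this.fderiv_eq, fderiv_clm_apply hd (differentiableAt_const e')]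
    simp
  · exact hd'.mdifferentiableAt.comp y (mdifferentiableAt_extChartAt hy)

theorem mlieBracket_symmL (x : M) (e e' : E) :
    VectorField.mlieBracket I
      (fun z => (trivializationAt E (TangentSpace I : M → Type _) x).symmL ℝ z e)
      (fun z => (trivializationAt E (TangentSpace I : M → Type _) x).symmL ℝ z e') x = 0 := by
  have hp (e : E) : VectorField.mpullbackWithin 𝓘(ℝ, E) I (extChartAt I x).symm
      (fun z => (trivializationAt E (TangentSpace I : M → Type _) x).symmL ℝ z e)
      (Set.range I) =ᶠ[𝓝 (extChartAt I x x)] fun _ => e := by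
    filter_upwards [extChartAt_target_mem_nhds x] with z hz
    have hs : (extChartAt I x).symm z ∈ (chartAt H x).source := by
      simpa using (extChartAt I x).map_target hz
    rw [VectorField.mpullbackWithin_apply, TangentBundle.symmL_trivializationAt hs,
      (extChartAt I x).right_inv hz]
    exact (isInvertible_mfderivWithin_extChartAt_symm hz).inverse_apply_self e
  have hl {V W : E → E} {p : E} (hV : V =ᶠ[𝓝 p] fun _ => e) (hW : W =ᶠ[𝓝 p] fun _ => e') :
      VectorField.lieBracketWithin ℝ V W Set.univ p = 0 := by
    rw [VectorField.lieBracketWithin_univ, hV.lieBracket_vectorField_eq hW]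
    simp [VectorField.lieBracket]
  rw [← VectorField.mlieBracketWithin_univ, VectorField.mlieBracketWithin_apply,
    Set.preimage_univ, Set.univ_inter, I.range_eq_univ]
  rw [I.range_eq_univ] at hp
  exact (congrArg _ (hl (hp e) (hp e'))).trans (map_zero _)

/-- The symmetry of second derivatives, for coordinate fields. -/
theorem pushDeriv_extendVec_comm {f : M → F} {x : M} (hf : ContMDiffAt I 𝓘(ℝ, F) 2 f x)
    (v w : TangentSpace I x) :
    pushDeriv I f (extendVec w) x v = pushDeriv I f (extendVec v) x w := by
  have h (v w : TangentSpace I x) : pushDeriv I f (extendVec w) x v =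
      fderiv ℝ (fderiv ℝ (f ∘ (extChartAt I x).symm)) (extChartAt I x x)
        ((trivializationAt E (TangentSpace I : M → Type _) x).continuousLinearMapAt ℝ x v)
        ((trivializationAt E (TangentSpace I : M → Type _) x).continuousLinearMapAt ℝ x w) := by
    rw [← pushDeriv_symmL (mem_chart_source H x) hf, Trivialization.symmL_continuousLinearMapAt _
      (FiberBundle.mem_baseSet_trivializationAt' x)]
    have : (fun y => mvfderiv I f y (extendVec w y)) =ᶠ[𝓝 x] fun y => mvfderiv I f y
        ((trivializationAt E (TangentSpace I : M → Type _) x).symmL ℝ y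
        ((trivializationAt E (TangentSpace I : M → Type _) x).continuousLinearMapAt ℝ x w)) := by
      filter_upwards [extendVec_eventuallyEq w] with y hy
      rw [hy]
    rw [pushDeriv, this.mvfderiv_eq, pushDeriv]
  rw [h, h]
  exact (contDiffAt_comp_extChartAt_symm two_le_infty
    (mem_chart_source H x) hf).isSymmSndFDerivAt (by simp) _ _

theorem mlieBracket_extendVec {x : M} (v w : TangentSpace I x) :
    VectorField.mlieBracket I (extendVec v) (extendVec w) x = 0 := by
  rw [Filter.EventuallyEq.mlieBracket_vectorField_eq (extendVec_eventuallyEq v)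
    (extendVec_eventuallyEq w), mlieBracket_symmL]

/-- `D_X (f_* Y) - D_Y (f_* X) = f_* [X, Y]`. -/
theorem pushDeriv_sub_pushDeriv {f : M → F} {x : M} (hf : ContMDiffAt I 𝓘(ℝ, F) 2 f x)
    {X Y : (x : M) → TangentSpace I x} (hX : MDiffAt (T% X) x) (hY : MDiffAt (T% Y) x) :
    pushDeriv I f Y x (X x) - pushDeriv I f X x (Y x) =
      mvfderiv I f x (VectorField.mlieBracket I X Y x) := by
  let Φ (X Y : (x : M) → TangentSpace I x) : F :=
    pushDeriv I f Y x (X x) - pushDeriv I f X x (Y x) -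
      mvfderiv I f x (VectorField.mlieBracket I X Y x)
  have hΦ (X Y) : Φ Y X = -Φ X Y := by
    simp only [Φ, VectorField.mlieBracket_swap_apply (V := Y) (W := X), map_neg]
    abel
  have h₂ (X : (x : M) → TangentSpace I x) (hX : MDiffAt (T% X) x) : TensorialAt I E (Φ X) x := by
    refine ⟨fun ha hY => ?_, fun hY hZ => ?_⟩
    · simp only [Φ, pushDeriv_smul hf ha hY, VectorField.mlieBracket_smul_right ha hY]
      simp [mvfderiv]
      module
    · simp only [Φ, pushDeriv_add hf hY hZ, VectorField.mlieBracket_add_right hY hZ]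
      simp
      abel
  have h₁ (Y : (x : M) → TangentSpace I x) (hY : MDiffAt (T% Y) x) :
      TensorialAt I E (fun X => Φ X Y) x := by
    refine ⟨fun ha hX => ?_, fun hX hZ => ?_⟩
    · rw [hΦ, (h₂ Y hY).smul ha hX, hΦ Y, smul_neg]
    · rw [hΦ, (h₂ Y hY).add hX hZ, neg_add, ← hΦ, ← hΦ]
  have key : Φ X Y = Φ (extendVec (X x)) (extendVec (Y x)) :=
    TensorialAt.pointwise₂ h₁ h₂ hX (mdifferentiableAt_extendVec _) hY
      (mdifferentiableAt_extendVec _) (extendVec_self _).symm (extendVec_self _).symm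
  have h0 : Φ (extendVec (X x)) (extendVec (Y x)) = 0 := by
    simp only [Φ, extendVec_self, mlieBracket_extendVec, map_zero, sub_zero]
    rw [pushDeriv_extendVec_comm hf, sub_self]
  exact sub_eq_zero.1 (key.trans h0)

end Immersions

section TransversalImmersions

variable {E : Type*} [NormedAddCommGroup E] [NormedSpace ℝ E] [FiniteDimensional ℝ E]
  {H : Type*} [TopologicalSpace H] {I : ModelWithCorners ℝ E H}
  {M : Type*} [TopologicalSpace M] [ChartedSpace H M] [IsManifold I ∞ M]
  {F : Type*} [NormedAddCommGroup F] [NormedSpace ℝ F]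

variable (I) in
/-- `f` is a smooth immersion of codimension one and `ξ` is a smooth transversal vector field. -/
structure IsTransversalImmersion (f ξ : M → F) : Prop where
  smooth : ContMDiff I 𝓘(ℝ, F) ∞ f
  smooth_normal : ContMDiff I 𝓘(ℝ, F) ∞ ξ
  invertible : ∀ x, (splitMap I f ξ x).IsInvertible

namespace IsTransversalImmersion

variable {f ξ : M → F} (hf : IsTransversalImmersion I f ξ)
include hf

/-! ### The two components of the splitting -/

theorem tangentPart_splitMap (x : M) (v : TangentSpace I x) (s : ℝ) :
    tangentPart I f ξ x (mvfderiv I f x v + s • ξ x) = v := by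
  have h := (hf.invertible x).inverse_apply_self (v, s)
  have h' : splitMap I f ξ x (v, s) = mvfderiv I f x v + s • ξ x := by simp [splitMap]
  rw [h'] at h
  exact congrArg Prod.fst h

theorem normalPart_splitMap (x : M) (v : TangentSpace I x) (s : ℝ) :
    normalPart I f ξ x (mvfderiv I f x v + s • ξ x) = s := by
  have h := (hf.invertible x).inverse_apply_self (v, s)
  have h' : splitMap I f ξ x (v, s) = mvfderiv I f x v + s • ξ x := by simp [splitMap]
  rw [h'] at h
  exact congrArg Prod.snd h

theorem mvfderiv_tangentPart_add (x : M) (a : F) :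
    mvfderiv I f x (tangentPart I f ξ x a) + normalPart I f ξ x a • ξ x = a := by
  have h := (hf.invertible x).self_apply_inverse a
  simpa [splitMap, tangentPart, normalPart] using h

theorem tangentPart_mvfderiv (x : M) (v : TangentSpace I x) :
    tangentPart I f ξ x (mvfderiv I f x v) = v := by
  simpa using hf.tangentPart_splitMap x v 0

theorem normalPart_mvfderiv (x : M) (v : TangentSpace I x) :
    normalPart I f ξ x (mvfderiv I f x v) = 0 := by
  simpa using hf.normalPart_splitMap x v 0

theorem normalPart_normal (x : M) : normalPart I f ξ x (ξ x) = 1 := by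
  simpa using hf.normalPart_splitMap x 0 1

theorem mvfderiv_add_smul_eq_zero {x : M} {v : TangentSpace I x} {s : ℝ}
    (h : mvfderiv I f x v + s • ξ x = 0) : v = 0 ∧ s = 0 := by
  have h₁ := hf.tangentPart_splitMap x v s
  have h₂ := hf.normalPart_splitMap x v s
  rw [h, map_zero] at h₁ h₂
  exact ⟨h₁.symm, h₂.symm⟩

theorem contMDiffAt_splitMap_comp_symmL (x : M) :
    ContMDiffAt I 𝓘(ℝ, E × ℝ →L[ℝ] F) ∞ (fun y => (mvfderiv I f y ∘L
      (trivializationAt E (TangentSpace I : M → Type _) x).symmL ℝ y).coprod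
        (ContinuousLinearMap.toSpanSingleton ℝ (ξ y))) x := by
  have h₁ := (contMDiffAt_mvfderiv_comp_symmL (n := ∞) (hf.smooth x) le_rfl).clm_comp
    (contMDiffAt_const (c := ContinuousLinearMap.fst ℝ E ℝ))
  have h₂ := (contMDiffAt_const (c := ContinuousLinearMap.smulRightL ℝ (E × ℝ) F
    (ContinuousLinearMap.snd ℝ E ℝ))).clm_apply (hf.smooth_normal x)
  refine (h₁.add h₂).congr_of_eventuallyEq (Filter.Eventually.of_forall fun y => ?_)
  ext p <;> simp

theorem isInvertible_splitMap_comp_symmL {x y : M} (hy : y ∈ (chartAt H x).source) :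
    ((mvfderiv I f y ∘L
      (trivializationAt E (TangentSpace I : M → Type _) x).symmL ℝ y).coprod
        (ContinuousLinearMap.toSpanSingleton ℝ (ξ y))).IsInvertible := by
  obtain ⟨e, he⟩ := hf.invertible y
  refine ⟨(((trivializationAt E (TangentSpace I : M → Type _) x).continuousLinearEquivAt ℝ y
    hy).symm.prodCongr (ContinuousLinearEquiv.refl ℝ ℝ)).trans e, ?_⟩
  have he' (p) : e p = splitMap I f ξ y p := congrArg (fun L => L p) he
  ext p
  · simp only [ContinuousLinearMap.comp_apply, ContinuousLinearMap.inl_apply,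
      ContinuousLinearEquiv.coe_coe, ContinuousLinearEquiv.trans_apply, he', splitMap,
      ContinuousLinearEquiv.prodCongr_apply, ContinuousLinearMap.coprod_apply, map_zero, add_zero]
    exact congrArg _ (congrFun (Trivialization.symm_continuousLinearEquivAt_eq _ hy) p)
  · simp [he', splitMap]

theorem inverse_splitMap_comp_symmL {x y : M} (hy : y ∈ (chartAt H x).source) (a : F) :
    ((mvfderiv I f y ∘L
      (trivializationAt E (TangentSpace I : M → Type _) x).symmL ℝ y).coprod
        (ContinuousLinearMap.toSpanSingleton ℝ (ξ y))).inverse a =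
      ((trivializationAt E (TangentSpace I : M → Type _) x).continuousLinearMapAt ℝ y
        (tangentPart I f ξ y a), normalPart I f ξ y a) := by
  rw [(hf.isInvertible_splitMap_comp_symmL hy).inverse_apply_eq]
  simp only [ContinuousLinearMap.coprod_apply, ContinuousLinearMap.comp_apply,
    ContinuousLinearMap.toSpanSingleton_apply]
  rw [Trivialization.symmL_continuousLinearMapAt _ hy, hf.mvfderiv_tangentPart_add]

theorem contMDiffAt_continuousLinearMapAt_comp_tangentPart (x : M) :
    ContMDiffAt I 𝓘(ℝ, F →L[ℝ] E) ∞ (fun y =>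
      (trivializationAt E (TangentSpace I : M → Type _) x).continuousLinearMapAt ℝ y ∘L
        tangentPart I f ξ y) x := by
  have : CompleteSpace E := FiniteDimensional.complete ℝ E
  have h := ((hf.isInvertible_splitMap_comp_symmL
    (mem_chart_source H x)).contDiffAt_map_inverse (n := ∞)).contMDiffAt.comp x
      (hf.contMDiffAt_splitMap_comp_symmL x)
  refine ((contMDiffAt_const (c := ContinuousLinearMap.fst ℝ E ℝ)).clm_comp
    h).congr_of_eventuallyEq ?_
  filter_upwards [(chartAt H x).open_source.mem_nhds (mem_chart_source H x)] with y hy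
  ext a
  simp [hf.inverse_splitMap_comp_symmL hy]

theorem contMDiff_normalPart : ContMDiff I 𝓘(ℝ, F →L[ℝ] ℝ) ∞ (normalPart I f ξ) := by
  intro x
  have : CompleteSpace E := FiniteDimensional.complete ℝ E
  have h := ((hf.isInvertible_splitMap_comp_symmL
    (mem_chart_source H x)).contDiffAt_map_inverse (n := ∞)).contMDiffAt.comp x
      (hf.contMDiffAt_splitMap_comp_symmL x)
  refine ((contMDiffAt_const (c := ContinuousLinearMap.snd ℝ E ℝ)).clm_comp
    h).congr_of_eventuallyEq ?_
  filter_upwards [(chartAt H x).open_source.mem_nhds (mem_chart_source H x)] with y hy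
  ext a
  simp [hf.inverse_splitMap_comp_symmL hy]

theorem continuousLinearMapAt_eventuallyEq (Y : (x : M) → TangentSpace I x) (x : M) :
    (fun y => (trivializationAt E (TangentSpace I : M → Type _) x ⟨y, Y y⟩).2) =ᶠ[𝓝 x]
      fun y => (trivializationAt E (TangentSpace I : M → Type _) x).continuousLinearMapAt ℝ y
        (Y y) := by
  filter_upwards [(chartAt H x).open_source.mem_nhds (mem_chart_source H x)] with y hy
  rw [Trivialization.continuousLinearMapAt_apply, Trivialization.coe_linearMapAt_of_mem _ hy]

theorem mdifferentiableAt_tangentPart {V : M → F} {x : M} (hV : MDiffAt V x) :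
    MDiffAt (T% (fun y => tangentPart I f ξ y (V y))) x := by
  rw [mdifferentiableAt_section]
  exact (((hf.contMDiffAt_continuousLinearMapAt_comp_tangentPart x).mdifferentiableAt
    (by simp)).clm_apply hV).congr_of_eventuallyEq (hf.continuousLinearMapAt_eventuallyEq _ x)

/-! ### The formulas of Gauss and Weingarten -/

theorem contMDiffAt_two (x : M) : ContMDiffAt I 𝓘(ℝ, F) 2 f x := (hf.smooth x).of_le two_le_infty

theorem tensorialAt_normalPart_pushDeriv (x : M) (v : TangentSpace I x) :
    TensorialAt I E (fun Y => normalPart I f ξ x (pushDeriv I f Y x v)) x := by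
  refine ⟨fun ha hY => ?_, fun hY hZ => ?_⟩
  · rw [pushDeriv_smul (hf.contMDiffAt_two x) ha hY]
    simp [hf.normalPart_mvfderiv]
  · rw [pushDeriv_add (hf.contMDiffAt_two x) hY hZ]
    simp

theorem normalPart_pushDeriv {x : M} {Y : (x : M) → TangentSpace I x} (hY : MDiffAt (T% Y) x)
    (v : TangentSpace I x) :
    normalPart I f ξ x (pushDeriv I f Y x v) = affineForm I f ξ x v (Y x) :=
  (hf.tensorialAt_normalPart_pushDeriv x v).pointwise hY (mdifferentiableAt_extendVec _)
    (extendVec_self _).symm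

/-- Gauss' formula `D_X (f_* Y) = f_* ∇_X Y + h(X, Y) ξ`. -/
theorem pushDeriv_eq {x : M} {Y : (x : M) → TangentSpace I x} (hY : MDiffAt (T% Y) x)
    (v : TangentSpace I x) :
    pushDeriv I f Y x v =
      mvfderiv I f x (inducedConn I f ξ Y x v) + affineForm I f ξ x v (Y x) • ξ x := by
  rw [← hf.normalPart_pushDeriv hY]
  exact (hf.mvfderiv_tangentPart_add x _).symm

/-- Weingarten's formula `D_X ξ = -f_* S X + τ(X) ξ`. -/
theorem mvfderiv_normal (x : M) (v : TangentSpace I x) :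
    mvfderiv I ξ x v =
      -mvfderiv I f x (shapeOperator I f ξ x v) + transversalForm I f ξ x v • ξ x := by
  have h := hf.mvfderiv_tangentPart_add x (mvfderiv I ξ x v)
  conv_lhs => rw [← h]
  simp [shapeOperator, transversalForm]

/-! ### The affine fundamental form -/

theorem affineForm_add_left (x : M) (v v' w : TangentSpace I x) :
    affineForm I f ξ x (v + v') w = affineForm I f ξ x v w + affineForm I f ξ x v' w := by
  simp [affineForm]

theorem affineForm_smul_left (x : M) (c : ℝ) (v w : TangentSpace I x) :
    affineForm I f ξ x (c • v) w = c * affineForm I f ξ x v w := by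
  simp [affineForm]

variable [I.Boundaryless]

theorem affineForm_comm (x : M) (v w : TangentSpace I x) :
    affineForm I f ξ x v w = affineForm I f ξ x w v := by
  rw [affineForm, affineForm, pushDeriv_extendVec_comm (hf.contMDiffAt_two x)]

theorem affineForm_add_right (x : M) (v w w' : TangentSpace I x) :
    affineForm I f ξ x v (w + w') = affineForm I f ξ x v w + affineForm I f ξ x v w' := by
  rw [hf.affineForm_comm, hf.affineForm_add_left, hf.affineForm_comm x w, hf.affineForm_comm x w']

theorem affineForm_smul_right (x : M) (c : ℝ) (v w : TangentSpace I x) :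
    affineForm I f ξ x v (c • w) = c * affineForm I f ξ x v w := by
  rw [hf.affineForm_comm, hf.affineForm_smul_left, hf.affineForm_comm x w]

omit hf in
variable (I f ξ) in
/-- The affine fundamental form as a continuous bilinear form. -/
noncomputable def affineFormL (hf : IsTransversalImmersion I f ξ) (x : M) :
    TangentSpace I x →L[ℝ] TangentSpace I x →L[ℝ] ℝ :=
  have : FiniteDimensional ℝ (TangentSpace I x) := inferInstanceAs (FiniteDimensional ℝ E)
  have : T2Space (TangentSpace I x) := inferInstanceAs (T2Space E)
  (LinearMap.mk₂ ℝ (affineForm I f ξ x) (hf.affineForm_add_left x) (hf.affineForm_smul_left x)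
    (hf.affineForm_add_right x)
    (fun c v w => hf.affineForm_smul_right x c v w)).toContinuousBilinearMap

theorem affineFormL_apply (x : M) (v w : TangentSpace I x) :
    affineFormL I f ξ hf x v w = affineForm I f ξ x v w :=
  rfl

set_option synthInstance.maxHeartbeats 400000 in
theorem contMDiff_affineFormL :
    ContMDiff I (I.prod 𝓘(ℝ, E →L[ℝ] E →L[ℝ] ℝ)) ∞
      (fun x => TotalSpace.mk' (E →L[ℝ] E →L[ℝ] ℝ)
        (E := fun x : M => TangentSpace I x →L[ℝ] TangentSpace I x →L[ℝ] ℝ) x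
        (affineFormL I f ξ hf x)) := by
  intro x
  rw [contMDiffAt_hom_bundle]
  refine ⟨contMDiffAt_id, ?_⟩
  have h₁ : ContMDiffAt I 𝓘(ℝ, E →L[ℝ] E →L[ℝ] F) ∞ (fun y => fderiv ℝ (fderiv ℝ
      (f ∘ (extChartAt I x).symm)) (extChartAt I x y)) x := by
    have h := contDiffAt_comp_extChartAt_symm (n := ∞) le_rfl (mem_chart_source H x) (hf.smooth x)
    exact ((h.fderiv_right (m := ∞) le_rfl).fderiv_right (m := ∞) le_rfl).contMDiffAt.comp x
      contMDiffAt_extChartAt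
  have h₂ := ((contMDiffAt_const (c := ContinuousLinearMap.compL ℝ E F ℝ)).clm_apply
    (hf.contMDiff_normalPart x)).clm_comp h₁
  refine h₂.congr_of_eventuallyEq ?_
  filter_upwards [(chartAt H x).open_source.mem_nhds (mem_chart_source H x)] with y hy
  ext v w
  have hw : MDiffAt (T% (fun z =>
      (trivializationAt E (TangentSpace I : M → Type _) x).symmL ℝ z w)) y := mdifferentiableAt_symmL hy w
  rw [inCoordinates_apply_eq₂ hy hy (Set.mem_univ y), affineFormL_apply,
    ← Trivialization.symmL_apply (R := ℝ) _ hy, ← Trivialization.symmL_apply (R := ℝ) _ hy,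
    ← hf.normalPart_pushDeriv hw, pushDeriv_symmL hy (hf.contMDiffAt_two y)]
  simp

theorem mdifferentiableAt_affineForm {x : M} {Y Z : (x : M) → TangentSpace I x}
    (hY : MDiffAt (T% Y) x) (hZ : MDiffAt (T% Z) x) :
    MDiffAt (fun y => affineForm I f ξ y (Y y) (Z y)) x := by
  have : MDifferentiableAt I (I.prod 𝓘(ℝ))
      (fun y => TotalSpace.mk' ℝ (E := Bundle.Trivial M ℝ) y
        (affineFormL I f ξ hf y (Y y) (Z y))) x := by
    apply MDifferentiableAt.clm_bundle_apply₂ (F₁ := E) (F₂ := E)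
    · exact (hf.contMDiff_affineFormL x).mdifferentiableAt (by simp)
    · exact hY
    · exact hZ
  simp only [mdifferentiableAt_totalSpace] at this
  exact this.2

/-! ### The induced connection -/

theorem isCovariantDerivativeOn_inducedConn :
    IsCovariantDerivativeOn (I := I) E (inducedConn I f ξ) Set.univ := by
  refine ⟨fun {Y Z x} hY hZ _ => ?_, fun {Y a x} hY ha _ => ?_⟩
  · rw [inducedConn, pushDeriv_add (hf.contMDiffAt_two x) hY hZ]
    ext v
    simp [inducedConn]
  · rw [inducedConn, pushDeriv_smul (hf.contMDiffAt_two x) ha hY]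
    ext v
    simp [inducedConn, hf.tangentPart_mvfderiv]

theorem torsion_free {x : M} {X Y : (x : M) → TangentSpace I x} (hX : MDiffAt (T% X) x)
    (hY : MDiffAt (T% Y) x) :
    inducedConn I f ξ Y x (X x) - inducedConn I f ξ X x (Y x) =
      VectorField.mlieBracket I X Y x := by
  rw [← hf.tangentPart_mvfderiv x (VectorField.mlieBracket I X Y x),
    ← pushDeriv_sub_pushDeriv (hf.contMDiffAt_two x) hX hY, map_sub]
  rfl

end IsTransversalImmersion

end TransversalImmersions

section StatisticalStructure

variable {E : Type*} [NormedAddCommGroup E] [NormedSpace ℝ E] [FiniteDimensional ℝ E]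
  {H : Type*} [TopologicalSpace H] {I : ModelWithCorners ℝ E H}
  {M : Type*} [TopologicalSpace M] [ChartedSpace H M] [IsManifold I ∞ M]
  {F : Type*} [NormedAddCommGroup F] [NormedSpace ℝ F]

/-- The unit ball of a positive definite form on a finite-dimensional space is bounded. -/
theorem isVonNBounded_of_posDef (B : E →L[ℝ] E →L[ℝ] ℝ)
    (hB : ∀ v, v ≠ 0 → 0 < B v v) : Bornology.IsVonNBounded ℝ {v | B v v < 1} := by
  have : ProperSpace E := FiniteDimensional.proper ℝ E
  have hc : Continuous fun v => B v v := B.continuous₂.comp (continuous_id.prodMk continuous_id)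
  rcases (Metric.sphere (0 : E) 1).eq_empty_or_nonempty with h | h
  · have : Subsingleton E := by
      by_contra hs
      rw [not_subsingleton_iff_nontrivial] at hs
      exact (NormedSpace.sphere_nonempty (x := (0 : E)).2 zero_le_one).ne_empty h
    rw [NormedSpace.isVonNBounded_iff' ℝ]
    exact ⟨0, fun v _ => by simp [Subsingleton.elim v 0]⟩
  · obtain ⟨u, hu, hmin⟩ := (isCompact_sphere (0 : E) 1).exists_isMinOn h hc.continuousOn
    have hu' : u ≠ 0 := by rintro rfl; simp at hu
    have hpos := hB u hu'
    rw [NormedSpace.isVonNBounded_iff' ℝ]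
    refine ⟨1 + 1 / B u u, fun v hv => ?_⟩
    rcases eq_or_ne v 0 with rfl | hv0
    · simpa using by positivity
    have hn : 0 < ‖v‖ := norm_pos_iff.2 hv0
    have h1 : B u u ≤ B (‖v‖⁻¹ • v) (‖v‖⁻¹ • v) := by
      apply hmin
      simp [norm_smul, hn.ne']
    simp only [map_smul, _root_.smul_apply, smul_eq_mul] at h1
    have h2 : B u u * ‖v‖ ^ 2 < 1 := by
      calc B u u * ‖v‖ ^ 2 ≤ ‖v‖⁻¹ * (‖v‖⁻¹ * B v v) * ‖v‖ ^ 2 := by gcongr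
        _ = B v v := by field_simp
        _ < 1 := hv
    have h3 : ‖v‖ ^ 2 < 1 / B u u := by rw [lt_div_iff₀ hpos]; linarith
    have h4 : 0 < 1 / B u u := by positivity
    nlinarith [sq_nonneg (‖v‖ - 1)]

/-! ### Covariant derivatives of Riemannian metrics -/

variable (I) in
/-- `g` is a smooth Riemannian metric. -/
def IsRiemannianForm (g : TangentForm I M) : Prop :=
  ∃ G : ContMDiffRiemannianMetric I ∞ E (TangentSpace I : M → Type _),
    ∀ x v w, G.inner x v w = g x v w

namespace IsRiemannianForm

variable {g : TangentForm I M} (hg : IsRiemannianForm I g)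
include hg

theorem add_left (x : M) (v v' w : TangentSpace I x) : g x (v + v') w = g x v w + g x v' w := by
  obtain ⟨G, hG⟩ := hg
  simp [← hG]

theorem smul_left (x : M) (c : ℝ) (v w : TangentSpace I x) : g x (c • v) w = c * g x v w := by
  obtain ⟨G, hG⟩ := hg
  simp [← hG]

theorem comm (x : M) (v w : TangentSpace I x) : g x v w = g x w v := by
  obtain ⟨G, hG⟩ := hg
  rw [← hG, ← hG, G.symm]

theorem pos (x : M) (v : TangentSpace I x) (hv : v ≠ 0) : 0 < g x v v := by
  obtain ⟨G, hG⟩ := hg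
  rw [← hG]
  exact G.pos x v hv

theorem add_right (x : M) (v w w' : TangentSpace I x) : g x v (w + w') = g x v w + g x v w' := by
  rw [hg.comm, hg.add_left, hg.comm x w, hg.comm x w']

theorem smul_right (x : M) (c : ℝ) (v w : TangentSpace I x) : g x v (c • w) = c * g x v w := by
  rw [hg.comm, hg.smul_left, hg.comm x w]

theorem sub_left (x : M) (v v' w : TangentSpace I x) : g x (v - v') w = g x v w - g x v' w := by
  rw [sub_eq_add_neg, ← neg_one_smul ℝ v', hg.add_left, hg.smul_left]
  ring

theorem mdifferentiableAt {x : M} {Y Z : (x : M) → TangentSpace I x}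
    (hY : MDiffAt (T% Y) x) (hZ : MDiffAt (T% Z) x) : MDiffAt (fun y => g y (Y y) (Z y)) x := by
  obtain ⟨G, hG⟩ := hg
  have : MDifferentiableAt I (I.prod 𝓘(ℝ))
      (fun y => TotalSpace.mk' ℝ (E := Bundle.Trivial M ℝ) y (G.inner y (Y y) (Z y))) x := by
    apply MDifferentiableAt.clm_bundle_apply₂ (F₁ := E) (F₂ := E)
    · exact (G.contMDiff x).mdifferentiableAt (by simp)
    · exact hY
    · exact hZ
  simp only [mdifferentiableAt_totalSpace] at this
  have h : MDiffAt (fun y => G.inner y (Y y) (Z y)) x := this.2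
  simpa only [hG] using h

theorem metricDeriv_comm (Y Z : (x : M) → TangentSpace I x) (x : M) (v : TangentSpace I x) :
    metricDeriv g Y Z x v = metricDeriv g Z Y x v := by
  rw [metricDeriv, metricDeriv, funext fun y => hg.comm y (Y y) (Z y)]

theorem metricDeriv_add {x : M} {Y Z Z' : (x : M) → TangentSpace I x}
    (hY : MDiffAt (T% Y) x) (hZ : MDiffAt (T% Z) x) (hZ' : MDiffAt (T% Z') x)
    (v : TangentSpace I x) :
    metricDeriv g Y (Z + Z') x v = metricDeriv g Y Z x v + metricDeriv g Y Z' x v := by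
  simp only [metricDeriv, Pi.add_apply, hg.add_right]
  exact mvfderiv_add_apply (hg.mdifferentiableAt hY hZ) (hg.mdifferentiableAt hY hZ') v

theorem metricDeriv_smul {x : M} {Y Z : (x : M) → TangentSpace I x} {a : M → ℝ}
    (hY : MDiffAt (T% Y) x) (ha : MDiffAt a x) (hZ : MDiffAt (T% Z) x) (v : TangentSpace I x) :
    metricDeriv g Y (a • Z) x v =
      a x * metricDeriv g Y Z x v + mvfderiv I a x v * g x (Y x) (Z x) := by
  simp only [metricDeriv, Pi.smul_apply', hg.smul_right]
  exact mvfderiv_smul_apply ha (hg.mdifferentiableAt hY hZ) v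

variable {nabla : AffineConn I M} (hn : IsCovariantDerivativeOn (I := I) E nabla Set.univ)
include hn

theorem tensorialAt_metricDeriv_sub {x : M} {Y : (x : M) → TangentSpace I x}
    (hY : MDiffAt (T% Y) x) (v : TangentSpace I x) :
    TensorialAt I E (fun Z => metricDeriv g Y Z x v - g x (Y x) (nabla Z x v)) x := by
  refine ⟨fun ha hZ => ?_, fun hZ hZ' => ?_⟩
  · rw [hg.metricDeriv_smul hY ha hZ, hn.leibniz hZ ha]
    simp [hg.add_right, hg.smul_right]
    ring
  · rw [hg.metricDeriv_add hY hZ hZ', hn.add hZ hZ']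
    simp [hg.add_right]
    ring

end IsRiemannianForm

variable (I) in
/-- The covariant derivative `(∇_u g)(v, w)` of a bilinear form. -/
noncomputable def covDerivForm (g : TangentForm I M) (nabla : AffineConn I M) (x : M)
    (u v w : TangentSpace I x) : ℝ :=
  metricDeriv g (extendVec v) (extendVec w) x u - g x (nabla (extendVec v) x u) w
    - g x v (nabla (extendVec w) x u)

theorem IsRiemannianForm.covDerivForm_eq {g : TangentForm I M} (hg : IsRiemannianForm I g)
    {nabla : AffineConn I M} (hn : IsCovariantDerivativeOn (I := I) E nabla Set.univ)
    {x : M} {Y Z : (x : M) → TangentSpace I x} (hY : MDiffAt (T% Y) x) (hZ : MDiffAt (T% Z) x)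
    (u : TangentSpace I x) :
    covDerivForm I g nabla x u (Y x) (Z x) =
      metricDeriv g Y Z x u - g x (nabla Y x u) (Z x) - g x (Y x) (nabla Z x u) := by
  have h₁ := (hg.tensorialAt_metricDeriv_sub hn (mdifferentiableAt_extendVec (Y x)) u).pointwise
    (mdifferentiableAt_extendVec (Z x)) hZ (extendVec_self _)
  have h₂ := (hg.tensorialAt_metricDeriv_sub hn hZ u).pointwise
    (mdifferentiableAt_extendVec (Y x)) hY (extendVec_self _)
  rw [hg.metricDeriv_comm, hg.metricDeriv_comm Z, hg.comm, hg.comm x (Z x)] at h₂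
  simp only [extendVec_self] at h₁
  rw [covDerivForm]
  linarith

namespace IsTransversalImmersion

variable {f ξ : M → F} (hf : IsTransversalImmersion I f ξ)
include hf

theorem contMDiffCovariantDerivativeOn_inducedConn :
    ContMDiffCovariantDerivativeOn (I := I) E ∞ (inducedConn I f ξ) Set.univ := by
  refine ⟨fun {Y} hY x _ => ContMDiffAt.contMDiffWithinAt ?_⟩
  rw [contMDiffAt_hom_bundle]
  refine ⟨contMDiffAt_id, ?_⟩
  have hY' : ContMDiffAt I (I.prod 𝓘(ℝ, E)) ∞ (fun y => TotalSpace.mk' E y (Y y)) x :=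
    (contMDiffOn_univ.1 hY x).of_le le_rfl
  have h := contMDiffAt_mvfderiv_comp_symmL (n := ∞)
    (ContMDiffAt.mvfderiv_apply (n := ∞) (hf.smooth x) le_rfl hY') le_rfl
  exact (hf.contMDiffAt_continuousLinearMapAt_comp_tangentPart x).clm_comp h

/-- `Y(h(X, Z)) + h(Y, ∇_X Z)` and `X(h(Y, Z)) + h(X, ∇_Y Z)` differ by `h([X, Y], Z)`, for a
coordinate field `Z`. -/
theorem metricDeriv_add_affineForm [I.Boundaryless] (hθ : ∀ x, transversalForm I f ξ x = 0)
    {x : M} {X Y : (x : M) → TangentSpace I x} (hX : MDiffAt (T% X) x) (hY : MDiffAt (T% Y) x)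
    (z : TangentSpace I x) :
    metricDeriv (affineForm I f ξ) Y (extendVec z) x (X x) +
        affineForm I f ξ x (X x) (inducedConn I f ξ (extendVec z) x (Y x)) -
      (metricDeriv (affineForm I f ξ) X (extendVec z) x (Y x) +
        affineForm I f ξ x (Y x) (inducedConn I f ξ (extendVec z) x (X x))) =
      affineForm I f ξ x (VectorField.mlieBracket I X Y x) z := by
  let ψ : M → F := fun y => mvfderiv I f y (extendVec z y)
  have hψ : ContMDiffAt I 𝓘(ℝ, F) ∞ ψ x :=
    (hf.smooth x).mvfderiv_apply le_rfl (contMDiffAt_extendVec z)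
  have hψ₂ := hψ.of_le two_le_infty
  have h (X Y : (x : M) → TangentSpace I x) (hX : MDiffAt (T% X) x) (hY : MDiffAt (T% Y) x) :
      normalPart I f ξ x (pushDeriv I ψ Y x (X x)) =
        metricDeriv (affineForm I f ξ) Y (extendVec z) x (X x) +
        affineForm I f ξ x (X x) (inducedConn I f ξ (extendVec z) x (Y x)) := by
    have hZY : MDiffAt (T% (fun y => inducedConn I f ξ (extendVec z) y (Y y))) x :=
      hf.mdifferentiableAt_tangentPart (hY.mvfderiv_apply hψ₂)
    have hh := hf.mdifferentiableAt_affineForm hY (mdifferentiableAt_extendVec z)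
    have hξ := (hf.smooth_normal x).mdifferentiableAt (by simp)
    have hs : MDiffAt (fun y => affineForm I f ξ y (Y y) (extendVec z y) • ξ y) x := hh.smul hξ
    have hev : (fun y => mvfderiv I ψ y (Y y)) =ᶠ[𝓝 x] fun y =>
        mvfderiv I f y (inducedConn I f ξ (extendVec z) y (Y y)) +
          affineForm I f ξ y (Y y) (extendVec z y) • ξ y := by
      filter_upwards [eventually_mdifferentiableAt_extendVec z] with y hy
      exact hf.pushDeriv_eq hy (Y y)
    rw [pushDeriv, hev.mvfderiv_eq, mvfderiv_add_apply
      (hZY.mvfderiv_apply (hf.contMDiffAt_two x)) hs, mvfderiv_smul_apply hh hξ,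
      hf.mvfderiv_normal, hθ, map_add, map_add, map_smul, map_smul]
    have h1 := hf.normalPart_pushDeriv hZY (X x)
    rw [pushDeriv] at h1
    rw [h1]
    simp [hf.normalPart_mvfderiv, hf.normalPart_normal, metricDeriv]
    ring
  rw [← h X Y hX hY, ← h Y X hY hX, ← map_sub, pushDeriv_sub_pushDeriv hψ₂ hX hY]
  exact (hf.normalPart_pushDeriv (mdifferentiableAt_extendVec z) _).trans
    (by rw [extendVec_self])

variable [I.Boundaryless]

theorem isRiemannianForm
    (hpos : ∀ (x : M) (v : TangentSpace I x), v ≠ 0 → 0 < affineForm I f ξ x v v) :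
    IsRiemannianForm I (affineForm I f ξ) :=
  ⟨{ inner := affineFormL I f ξ hf
     symm := hf.affineForm_comm
     pos := hpos
     isVonNBounded := fun x => isVonNBounded_of_posDef (E := E) (affineFormL I f ξ hf x) (hpos x)
     contMDiff := hf.contMDiff_affineFormL }, fun _ _ _ => rfl⟩

/-- The induced connection and the affine fundamental form of an equiaffine locally strongly convex
hypersurface form a statistical structure. -/
theorem isStatisticalStructure (hθ : ∀ x, transversalForm I f ξ x = 0)
    (hpos : ∀ (x : M) (v : TangentSpace I x), v ≠ 0 → 0 < affineForm I f ξ x v v) :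
    IsStatisticalStructure I (affineForm I f ξ) (inducedConn I f ξ) := by
  have hg := hf.isRiemannianForm hpos
  have hn := hf.isCovariantDerivativeOn_inducedConn
  refine ⟨hg, hn, hf.contMDiffCovariantDerivativeOn_inducedConn,
    fun x X Y hX hY => hf.torsion_free hX hY, fun x X Y Z hX hY hZ => ?_⟩
  have hz := mdifferentiableAt_extendVec (Z x)
  have h₀ := hf.metricDeriv_add_affineForm hθ hX hY (Z x)
  have h₁ := hg.covDerivForm_eq hn hY hz (X x)
  have h₂ := hg.covDerivForm_eq hn hX hz (Y x)
  have h₃ := hg.covDerivForm_eq hn hY hZ (X x)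
  have h₄ := hg.covDerivForm_eq hn hX hZ (Y x)
  rw [extendVec_self] at h₁ h₂
  rw [← hf.torsion_free hX hY, hg.sub_left] at h₀
  linarith

end IsTransversalImmersion

end StatisticalStructure

section TraceAndSharp

variable {E : Type*} [NormedAddCommGroup E] [NormedSpace ℝ E] [FiniteDimensional ℝ E]
  {H : Type*} [TopologicalSpace H] {I : ModelWithCorners ℝ E H}
  {M : Type*} [TopologicalSpace M] [ChartedSpace H M] [IsManifold I ∞ M]

theorem linearize_apply {x : M} {W : Type*} [AddCommGroup W] [Module ℝ W] [TopologicalSpace W]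
    [IsTopologicalAddGroup W] [ContinuousSMul ℝ W] {F : TangentSpace I x → W}
    (L : TangentSpace I x →ₗ[ℝ] W) (h : ∀ v, F v = L v) (v : TangentSpace I x) :
    linearize F v = F v := by
  have : (tangentBasis I x).constr ℝ (fun i => F (tangentBasis I x i)) = L :=
    (tangentBasis I x).ext fun i => by rw [Module.Basis.constr_basis, h]
  rw [h, ← this]
  rfl

variable {x : M} {g : TangentSpace I x → TangentSpace I x → ℝ} {W : Type*} [AddCommGroup W]
  [Module ℝ W]

theorem metricTrace_add (B B' : TangentSpace I x → TangentSpace I x → W) :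
    metricTrace g (fun v w => B v w + B' v w) = metricTrace g B + metricTrace g B' := by
  simp [metricTrace, Finset.sum_add_distrib]

theorem metricTrace_linearMap {W' : Type*} [AddCommGroup W'] [Module ℝ W'] (L : W →ₗ[ℝ] W')
    (B : TangentSpace I x → TangentSpace I x → W) :
    metricTrace g (fun v w => L (B v w)) = L (metricTrace g B) := by
  simp [metricTrace]

theorem metricTrace_smul (c : ℝ) (B : TangentSpace I x → TangentSpace I x → W) :
    metricTrace g (fun v w => c • B v w) = c • metricTrace g B := by
  simp only [metricTrace, Finset.smul_sum, smul_comm c]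

theorem metricTrace_smul_const (B : TangentSpace I x → TangentSpace I x → ℝ) (a : W) :
    metricTrace g (fun v w => B v w • a) = metricTrace g B • a :=
  metricTrace_linearMap (LinearMap.toSpanSingleton ℝ W a) B

theorem metricSharp_add (φ ψ : TangentSpace I x → ℝ) :
    metricSharp g (fun w => φ w + ψ w) = metricSharp g φ + metricSharp g ψ := by
  simp only [metricSharp, add_smul, metricTrace_add]

theorem metricSharp_smul (c : ℝ) (φ : TangentSpace I x → ℝ) :
    metricSharp g (fun w => c * φ w) = c • metricSharp g φ := by
  simp only [metricSharp, mul_smul, metricTrace_smul]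

end TraceAndSharp

section RiemannianForm

variable {E : Type*} [NormedAddCommGroup E] [NormedSpace ℝ E] [FiniteDimensional ℝ E]
  {H : Type*} [TopologicalSpace H] {I : ModelWithCorners ℝ E H}
  {M : Type*} [TopologicalSpace M] [ChartedSpace H M] [IsManifold I ∞ M]

variable (I) in
/-- The Gram matrix of a bilinear form in the basis used for traces. -/
noncomputable def gramMatrix (g : TangentForm I M) (x : M) :
    Matrix (Fin (Module.finrank ℝ E)) (Fin (Module.finrank ℝ E)) ℝ :=
  Matrix.of fun k l => g x (tangentBasis I x k) (tangentBasis I x l)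

namespace IsRiemannianForm

variable {g : TangentForm I M} (hg : IsRiemannianForm I g)
include hg

omit hg in
variable (I g) in
/-- A Riemannian metric at a point as a bilinear map. -/
noncomputable def toBilin (hg : IsRiemannianForm I g) (x : M) :
    TangentSpace I x →ₗ[ℝ] TangentSpace I x →ₗ[ℝ] ℝ :=
  LinearMap.mk₂ ℝ (g x) (hg.add_left x) (hg.smul_left x) (hg.add_right x)
    fun c v w => hg.smul_right x c v w

theorem toBilin_apply (x : M) (v w : TangentSpace I x) : hg.toBilin I g x v w = g x v w := rfl

theorem isUnit_det_gramMatrix (x : M) : IsUnit (gramMatrix I g x).det := by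
  rw [isUnit_iff_ne_zero]
  intro h
  obtain ⟨c, hc, hc'⟩ := Matrix.exists_mulVec_eq_zero_iff.2 h
  let v : TangentSpace I x := ∑ i, c i • tangentBasis I x i
  have hv : v ≠ 0 := fun h0 => hc <| funext fun i =>
    Fintype.linearIndependent_iff.1 (tangentBasis I x).linearIndependent c h0 i
  have h1 (i) : g x (tangentBasis I x i) v = 0 := by
    have := congrFun hc' i
    rw [← hg.toBilin_apply]
    simpa [v, Matrix.mulVec, dotProduct, gramMatrix, toBilin_apply, mul_comm] using this
  have h2 : g x v v = 0 := by
    have : hg.toBilin I g x v = ∑ i, c i • hg.toBilin I g x (tangentBasis I x i) := by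
      simp [v]
    rw [← hg.toBilin_apply, this]
    simp [LinearMap.sum_apply, toBilin_apply, h1]
  exact (hg.pos x v hv).ne' h2

theorem sum_inv_mul (x : M) (i k : Fin (Module.finrank ℝ E)) :
    ∑ j, (gramMatrix I g x)⁻¹ i j * g x (tangentBasis I x j) (tangentBasis I x k) =
      if i = k then 1 else 0 := by
  have := congrFun (congrFun (Matrix.nonsing_inv_mul _ (hg.isUnit_det_gramMatrix x)) i) k
  simpa [Matrix.mul_apply, Matrix.one_apply, gramMatrix] using this

theorem metricSharp_apply (x : M) (φ : TangentSpace I x →ₗ[ℝ] ℝ) (w : TangentSpace I x) :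
    g x (metricSharp (g x) φ) w = φ w := by
  have : hg.toBilin I g x (metricSharp (g x) φ) = φ := by
    refine (tangentBasis I x).ext fun k => ?_
    rw [metricSharp, ← LinearMap.flip_apply, ← metricTrace_linearMap, metricTrace]
    have hi (i) : ∑ j, (gramMatrix I g x)⁻¹ i j • ((hg.toBilin I g x).flip (tangentBasis I x k))
        (φ (tangentBasis I x i) • tangentBasis I x j) =
        φ (tangentBasis I x i) * if i = k then 1 else 0 := by
      rw [← hg.sum_inv_mul x, Finset.mul_sum]
      refine Finset.sum_congr rfl fun j _ => ?_
      simp [toBilin_apply]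
      ring
    exact (Finset.sum_congr rfl fun i _ => hi i).trans (by simp)
  rw [← hg.toBilin_apply, this]

theorem eq_of_forall_eq {x : M} {v v' : TangentSpace I x} (h : ∀ w, g x v w = g x v' w) :
    v = v' := by
  by_contra hne
  have := hg.pos x (v - v') (sub_ne_zero.2 hne)
  rw [hg.sub_left, h, sub_self] at this
  exact this.false

theorem metricSharp_left (x : M) (v : TangentSpace I x) : metricSharp (g x) (g x v) = v :=
  hg.eq_of_forall_eq fun w => hg.metricSharp_apply x (hg.toBilin I g x v) w

/-- `tr_g g(·, A ·) = tr A`. -/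
theorem metricTrace_endomorphism (x : M) (A : TangentSpace I x →ₗ[ℝ] TangentSpace I x) :
    metricTrace (g x) (fun v w => g x v (A w)) = LinearMap.trace ℝ _ A := by
  rw [LinearMap.trace_eq_matrix_trace ℝ (tangentBasis I x), Matrix.trace]
  have h (j) : ∑ i, (gramMatrix I g x)⁻¹ i j * g x (tangentBasis I x i) (A (tangentBasis I x j)) =
      LinearMap.toMatrix (tangentBasis I x) (tangentBasis I x) A j j := by
    have hA := (tangentBasis I x).sum_repr (A (tangentBasis I x j))
    have hsymm (i) : (gramMatrix I g x)⁻¹ i j = (gramMatrix I g x)⁻¹ j i := by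
      have : (gramMatrix I g x).transpose = gramMatrix I g x := by
        ext k l
        exact hg.comm x _ _
      rw [← Matrix.transpose_apply (gramMatrix I g x)⁻¹, Matrix.transpose_nonsing_inv, this]
    have h1 (i) : g x (tangentBasis I x i) (A (tangentBasis I x j)) =
        ∑ k, (tangentBasis I x).repr (A (tangentBasis I x j)) k *
          g x (tangentBasis I x i) (tangentBasis I x k) := by
      rw [← hg.toBilin_apply]
      conv_lhs => rw [← hA]
      rw [map_sum]
      simp only [map_smul, smul_eq_mul]
      rfl
    simp_rw [h1, Finset.mul_sum, hsymm]
    rw [Finset.sum_comm]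
    have h2 (k) : ∑ i, (gramMatrix I g x)⁻¹ j i *
        ((tangentBasis I x).repr (A (tangentBasis I x j)) k *
          g x (tangentBasis I x i) (tangentBasis I x k)) =
        (tangentBasis I x).repr (A (tangentBasis I x j)) k * if j = k then 1 else 0 := by
      rw [← hg.sum_inv_mul x, Finset.mul_sum]
      exact Finset.sum_congr rfl fun i _ => by ring
    simp_rw [h2]
    simp [LinearMap.toMatrix_apply]
  rw [metricTrace, Finset.sum_comm]
  exact Finset.sum_congr rfl fun j _ => h j

theorem metricTrace_self (x : M) : metricTrace (g x) (g x) = Module.finrank ℝ E := by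
  have h := hg.metricTrace_endomorphism x LinearMap.id
  have : Module.Finite ℝ (TangentSpace I x) := inferInstanceAs (FiniteDimensional ℝ E)
  rw [LinearMap.trace_id] at h
  exact h

end IsRiemannianForm

end RiemannianForm

section StatisticalConnections

variable {E : Type*} [NormedAddCommGroup E] [NormedSpace ℝ E] [FiniteDimensional ℝ E]
  {H : Type*} [TopologicalSpace H] {I : ModelWithCorners ℝ E H}
  {M : Type*} [TopologicalSpace M] [ChartedSpace H M] [IsManifold I ∞ M]

namespace IsStatisticalStructure

variable {g : TangentForm I M} {nabla : AffineConn I M} (hs : IsStatisticalStructure I g nabla)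
include hs

theorem isRiemannianForm : IsRiemannianForm I g := hs.riemannian

theorem covDerivForm_eq {x : M} {Y Z : (x : M) → TangentSpace I x} (hY : MDiffAt (T% Y) x)
    (hZ : MDiffAt (T% Z) x) (u : TangentSpace I x) :
    covDerivForm I g nabla x u (Y x) (Z x) =
      metricDeriv g Y Z x u - g x (nabla Y x u) (Z x) - g x (Y x) (nabla Z x u) :=
  hs.isRiemannianForm.covDerivForm_eq hs.connection hY hZ u

theorem covDerivForm_comm (x : M) (u v w : TangentSpace I x) :
    covDerivForm I g nabla x u v w = covDerivForm I g nabla x u w v := by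
  have hg := hs.isRiemannianForm
  rw [covDerivForm, covDerivForm, hg.metricDeriv_comm, hg.comm x _ w, hg.comm x v]
  ring

theorem covDerivForm_swap (x : M) (u v w : TangentSpace I x) :
    covDerivForm I g nabla x u v w = covDerivForm I g nabla x v u w := by
  have h := hs.codazzi x (extendVec u) (extendVec v) (extendVec w) (mdifferentiableAt_extendVec u)
    (mdifferentiableAt_extendVec v) (mdifferentiableAt_extendVec w)
  simp only [extendVec_self] at h
  exact h

theorem covDerivForm_add (x : M) (u u' v w : TangentSpace I x) :
    covDerivForm I g nabla x (u + u') v w =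
      covDerivForm I g nabla x u v w + covDerivForm I g nabla x u' v w := by
  have hg := hs.isRiemannianForm
  simp only [covDerivForm, metricDeriv, map_add, hg.add_left, hg.add_right]
  ring

theorem covDerivForm_smul (x : M) (c : ℝ) (u v w : TangentSpace I x) :
    covDerivForm I g nabla x (c • u) v w = c * covDerivForm I g nabla x u v w := by
  have hg := hs.isRiemannianForm
  simp only [covDerivForm, metricDeriv, map_smul, hg.smul_left, hg.smul_right, smul_eq_mul]
  ring

omit hs in
variable (I g nabla) in
/-- The bilinear map `(v, w) ↦ C(v, w)` with `g(C(v, w), z) = (∇_v g)(w, z)`. -/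
noncomputable def cubicSharp (hs : IsStatisticalStructure I g nabla) (x : M) :
    TangentSpace I x →ₗ[ℝ] TangentSpace I x →ₗ[ℝ] TangentSpace I x :=
  LinearMap.mk₂ ℝ (fun v w => metricSharp (g x) (covDerivForm I g nabla x v w))
    (fun v v' w => by
      simp only [← metricSharp_add, ← hs.covDerivForm_add])
    (fun c v w => by
      simp only [← metricSharp_smul, ← hs.covDerivForm_smul])
    (fun v w w' => by
      rw [← metricSharp_add, funext fun z => (hs.covDerivForm_swap x v (w + w') z).trans
        (hs.covDerivForm_add x w w' v z)]
      simp only [hs.covDerivForm_swap x v])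
    (fun c v w => by
      rw [← metricSharp_smul, funext fun z => (hs.covDerivForm_swap x v (c • w) z).trans
        (hs.covDerivForm_smul x c w v z)]
      simp only [hs.covDerivForm_swap x v])

theorem inner_cubicSharp (x : M) (v w z : TangentSpace I x) :
    g x (cubicSharp I g nabla hs x v w) z = covDerivForm I g nabla x v w z := by
  have h (z) : covDerivForm I g nabla x v w z = covDerivForm I g nabla x z v w := by
    rw [hs.covDerivForm_comm, hs.covDerivForm_swap, hs.covDerivForm_comm, hs.covDerivForm_comm]
  exact hs.isRiemannianForm.metricSharp_apply x
    ⟨⟨covDerivForm I g nabla x v w, fun a b => by simp only [h, hs.covDerivForm_add]⟩,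
      fun c a => by simp only [h, hs.covDerivForm_smul]; rfl⟩ z

theorem conjugateConn_apply {x : M} {Z : (x : M) → TangentSpace I x} (hZ : MDiffAt (T% Z) x)
    (v : TangentSpace I x) :
    conjugateConn g nabla Z x v = nabla Z x v + cubicSharp I g nabla hs x v (Z x) := by
  have hg := hs.isRiemannianForm
  have h (v : TangentSpace I x) : (metricSharp (g x) fun w =>
      metricDeriv g (extendVec w) Z x v - g x (nabla (extendVec w) x v) (Z x)) =
      ((nabla Z x).toLinearMap + (cubicSharp I g nabla hs x).flip (Z x)) v := by
    have h1 : (fun w => metricDeriv g (extendVec w) Z x v - g x (nabla (extendVec w) x v) (Z x)) =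
        fun w => g x (nabla Z x v) w + covDerivForm I g nabla x v (Z x) w := by
      funext w
      have := hs.covDerivForm_eq (mdifferentiableAt_extendVec w) hZ v
      rw [extendVec_self] at this
      rw [hs.covDerivForm_comm, this, hg.comm x _ w]
      ring
    rw [h1, metricSharp_add, hg.metricSharp_left]
    rfl
  rw [conjugateConn, linearize_apply _ h, h]
  rfl

theorem leviCivita_apply {x : M} {Y : (x : M) → TangentSpace I x} (hY : MDiffAt (T% Y) x)
    (v : TangentSpace I x) :
    leviCivita g Y x v = nabla Y x v + (1 / 2 : ℝ) • cubicSharp I g nabla hs x v (Y x) := by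
  have hg := hs.isRiemannianForm
  have h (v : TangentSpace I x) : (metricSharp (g x) fun w =>
      (1 / 2 : ℝ) *
      (metricDeriv g Y (extendVec w) x v
        + metricDeriv g (extendVec v) (extendVec w) x (Y x)
        - metricDeriv g (extendVec v) Y x w
        + g x (VectorField.mlieBracket I (extendVec v) Y x) w
        - g x (VectorField.mlieBracket I (extendVec v) (extendVec w) x) (Y x)
        - g x (VectorField.mlieBracket I Y (extendVec w) x) v)) =
      ((nabla Y x).toLinearMap + (1 / 2 : ℝ) • (cubicSharp I g nabla hs x).flip (Y x)) v := by
    have h1 (w : TangentSpace I x) : (1 / 2 : ℝ) *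
      (metricDeriv g Y (extendVec w) x v
        + metricDeriv g (extendVec v) (extendVec w) x (Y x)
        - metricDeriv g (extendVec v) Y x w
        + g x (VectorField.mlieBracket I (extendVec v) Y x) w
        - g x (VectorField.mlieBracket I (extendVec v) (extendVec w) x) (Y x)
        - g x (VectorField.mlieBracket I Y (extendVec w) x) v) =
        g x (nabla Y x v) w + (1 / 2 : ℝ) * covDerivForm I g nabla x v (Y x) w := by
      have hv := mdifferentiableAt_extendVec v
      have hw := mdifferentiableAt_extendVec w
      have e1 := hs.covDerivForm_eq hY hw v
      have e2 := hs.covDerivForm_eq hv hw (Y x)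
      have e3 := hs.covDerivForm_eq hv hY w
      have t1 := hs.torsion_free x _ _ hv hY
      have t2 := hs.torsion_free x _ _ hv hw
      have t3 := hs.torsion_free x _ _ hY hw
      have s1 := hs.covDerivForm_swap x v (Y x) w
      have s2 := hs.covDerivForm_comm x w v (Y x)
      have s3 := hs.covDerivForm_swap x w (Y x) v
      have s4 := hs.covDerivForm_comm x (Y x) w v
      have c1 := hg.comm x (Y x) (nabla (extendVec w) x v)
      have c2 := hg.comm x v (nabla (extendVec w) x (Y x))
      have c3 := hg.comm x v (nabla Y x w)
      simp only [extendVec_self] at e1 e2 e3 t1 t2 t3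
      rw [← t1, ← t2, ← t3, hg.sub_left, hg.sub_left, hg.sub_left]
      linarith
    rw [funext h1, metricSharp_add, hg.metricSharp_left, metricSharp_smul]
    rfl
  rw [leviCivita, linearize_apply _ h, h]
  rfl

theorem differenceTensor_apply (x : M) (v w : TangentSpace I x) :
    differenceTensor g nabla x v w = (-(1 / 2) : ℝ) • cubicSharp I g nabla hs x v w := by
  rw [differenceTensor, hs.leviCivita_apply (mdifferentiableAt_extendVec w), extendVec_self]
  module

theorem metricTrace_cubicSharp {x : M}
    (h : ∀ z, metricTrace (g x) (covDerivForm I g nabla x z) = 0) :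
    metricTrace (g x) (fun v w => cubicSharp I g nabla hs x v w) = 0 := by
  have hg := hs.isRiemannianForm
  refine hg.eq_of_forall_eq fun z => ?_
  have h0 : g x 0 z = 0 := by simpa using hg.smul_left x 0 0 z
  rw [h0, ← h z, ← hg.toBilin_apply, ← LinearMap.flip_apply, ← metricTrace_linearMap]
  congr 1
  funext v w
  rw [LinearMap.flip_apply, hg.toBilin_apply, hs.inner_cubicSharp, hs.covDerivForm_comm,
    hs.covDerivForm_swap, hs.covDerivForm_comm, hs.covDerivForm_comm,
    hs.covDerivForm_swap]

theorem traceK_eq_zero {x : M} (h : ∀ z, metricTrace (g x) (covDerivForm I g nabla x z) = 0) :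
    traceK g nabla x = 0 := by
  have := hs.metricTrace_cubicSharp h
  rw [traceK, funext fun v => funext fun w => hs.differenceTensor_apply x v w, metricTrace_smul,
    this, smul_zero]

theorem metricDiv_zero (x : M) : metricDiv g (fun _ => 0) x = 0 := by
  have h : leviCivita g (fun _ => 0) x = 0 := by
    ext v
    have h0 := hs.leviCivita_apply (Y := fun _ => 0) (mdifferentiableAt_zeroSection ℝ _) v
    have h1 : nabla (fun _ => 0) x = 0 := hs.connection.zero
    rw [h0, h1]
    simp
  rw [metricDiv, h]
  simp

end IsStatisticalStructure

end StatisticalConnections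

section Determinants

/-- Jacobi's formula for the derivative of a determinant. -/
theorem fderiv_det_apply {E : Type*} [NormedAddCommGroup E] [NormedSpace ℝ E] {ι : Type*}
    [Fintype ι] [DecidableEq ι] {A : E → Matrix ι ι ℝ} {p : E}
    (hA : ∀ i j, DifferentiableAt ℝ (fun q => A q i j) p) (v : E) :
    fderiv ℝ (fun q => (A q).det) p v =
      ((Matrix.of fun i j => fderiv ℝ (fun q => A q i j) p v) * (A p).adjugate).trace := by
  let D : ContinuousMultilinearMap ℝ (fun _ : ι => ι → ℝ) ℝ :=
    { toMultilinearMap := (Matrix.detRowAlternating (n := ι) (R := ℝ)).toMultilinearMap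
      cont := Continuous.matrix_det continuous_id }
  have hA' : HasFDerivAt (fun q => (A q : ι → ι → ℝ))
      (ContinuousLinearMap.pi fun i => ContinuousLinearMap.pi fun j =>
        fderiv ℝ (fun q => A q i j) p) p :=
    hasFDerivAt_pi.2 fun i => hasFDerivAt_pi.2 fun j => (hA i j).hasFDerivAt
  have h := (D.hasFDerivAt (A p)).comp p hA'
  have h' : fderiv ℝ (fun q => (A q).det) p = _ := h.fderiv
  refine (congrArg (fun L => L v) h').trans ((ContinuousMultilinearMap.linearDeriv_apply D _ _).trans
    ?_)
  rw [Matrix.trace]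
  refine Finset.sum_congr rfl fun i _ => ?_
  have h2 (B : ι → ℝ) : D (Function.update (A p : ι → ι → ℝ) i B) =
    ((A p).updateRow i B).det := rfl
  refine (h2 _).trans ?_
  rw [← Matrix.cramer_transpose_apply, Matrix.cramer_eq_adjugate_mulVec,
    ← Matrix.adjugate_transpose, Matrix.diag_apply, Matrix.mul_apply]
  simp [Matrix.mulVec, dotProduct, mul_comm]

variable {E : Type*} [NormedAddCommGroup E] [NormedSpace ℝ E] [FiniteDimensional ℝ E]
  {H : Type*} [TopologicalSpace H] {I : ModelWithCorners ℝ E H} [I.Boundaryless]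
  {M : Type*} [TopologicalSpace M] [ChartedSpace H M] [IsManifold I ∞ M]
  {F : Type*} [NormedAddCommGroup F] [NormedSpace ℝ F]

theorem mvfderiv_eq_fderiv_comp_symm {f : M → F} {x : M} (hf : MDiffAt f x)
    (v : TangentSpace I x) :
    mvfderiv I f x v = fderiv ℝ (f ∘ (extChartAt I x).symm) (extChartAt I x x)
      ((trivializationAt E (TangentSpace I : M → Type _) x).continuousLinearMapAt ℝ x v) := by
  rw [← mvfderiv_symmL (mem_chart_source H x) hf, Trivialization.symmL_continuousLinearMapAt _
      (FiberBundle.mem_baseSet_trivializationAt' x)]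

theorem differentiableAt_comp_extChartAt_symm {f : M → F} {x : M} (hf : MDiffAt f x) :
    DifferentiableAt ℝ (f ∘ (extChartAt I x).symm) (extChartAt I x x) := by
  have h := hf.differentiableWithinAt_writtenInExtChartAt
  rw [I.range_eq_univ, differentiableWithinAt_univ] at h
  exact h

theorem mdifferentiableAt_det {ι : Type} [Fintype ι] [DecidableEq ι] {A : M → Matrix ι ι ℝ} {x : M}
    (hA : ∀ i j, MDiffAt (fun y => A y i j) x) : MDiffAt (fun y => (A y).det) x := by
  have h₁ (σ : Equiv.Perm ι) : MDiffAt (fun y => ∏ i, A y (σ i) i) x := by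
    have := MDifferentiableAt.prod (t := Finset.univ) (f := fun i y => A y (σ i) i)
      fun i _ => hA (σ i) i
    rwa [Finset.prod_fn] at this
  have h₂ := MDifferentiableAt.sum (t := Finset.univ)
    fun (σ : Equiv.Perm ι) _ => (mdifferentiableAt_const (c := ((σ.sign : ℤ) : ℝ))).mul (h₁ σ)
  simp only [Matrix.det_apply']
  rwa [Finset.sum_fn] at h₂

theorem mvfderiv_det_apply {ι : Type} [Fintype ι] [DecidableEq ι] {A : M → Matrix ι ι ℝ} {x : M}
    (hA : ∀ i j, MDiffAt (fun y => A y i j) x) (v : TangentSpace I x) :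
    mvfderiv I (fun y => (A y).det) x v =
      ((Matrix.of fun i j => mvfderiv I (fun y => A y i j) x v) * (A x).adjugate).trace := by
  have h := fderiv_det_apply (A := fun q => A ((extChartAt I x).symm q))
    (fun i j => differentiableAt_comp_extChartAt_symm (hA i j))
    ((trivializationAt E (TangentSpace I : M → Type _) x).continuousLinearMapAt ℝ x v)
  rw [(extChartAt I x).left_inv (mem_extChartAt_source x)] at h
  rw [mvfderiv_eq_fderiv_comp_symm (mdifferentiableAt_det hA)]
  refine h.trans ?_
  congr 3
  funext i j
  exact (mvfderiv_eq_fderiv_comp_symm (hA i j) v).symm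

theorem IsRiemannianForm.det_nonneg {g : TangentForm I M} (hg : IsRiemannianForm I g) {n : ℕ}
    {x : M} (X : Fin n → TangentSpace I x) :
    0 ≤ (Matrix.of fun i j => g x (X i) (X j)).det := by
  refine (Matrix.PosSemidef.of_dotProduct_mulVec_nonneg ?_ fun c => ?_).det_nonneg
  · ext i j
    exact hg.comm x _ _
  · have h : star c ⬝ᵥ (Matrix.of fun i j => g x (X i) (X j)).mulVec c =
        hg.toBilin I g x (∑ i, c i • X i) (∑ i, c i • X i) := by
      simp only [map_sum, map_smul, LinearMap.sum_apply, LinearMap.smul_apply, smul_eq_mul,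
        hg.toBilin_apply, dotProduct, Matrix.mulVec, Matrix.of_apply, Pi.star_apply, star_trivial,
        Finset.mul_sum]
      rw [Finset.sum_comm]
      refine Finset.sum_congr rfl fun i _ => Finset.sum_congr rfl fun j _ => ?_
      rw [hg.comm]
      ring
    rw [h, hg.toBilin_apply]
    rcases eq_or_ne (∑ i, c i • X i) 0 with h0 | h0
    · rw [h0, ← hg.toBilin_apply]
      simp
    · exact (hg.pos x _ h0).le

theorem Module.Basis.toMatrix_mul_of_sum {ι : Type*} [Fintype ι] (b : Module.Basis ι ℝ F)
    {v w : ι → F} {Q : Matrix ι ι ℝ} (h : ∀ l, w l = ∑ k, Q k l • v k) :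
    b.toMatrix w = b.toMatrix v * Q := by
  ext k l
  simp [Module.Basis.toMatrix_apply, h, Matrix.mul_apply, mul_comm]

open Matrix in
/-- The derivative of the Gram determinant of a frame. -/
theorem IsStatisticalStructure.mvfderiv_det_gramMatrix {g : TangentForm I M} {nabla : AffineConn I M}
    (hs : IsStatisticalStructure I g nabla) (x : M) (z : TangentSpace I x) :
    mvfderiv I (fun y => (Matrix.of fun i j => g y (extendVec (tangentBasis I x i) y)
      (extendVec (tangentBasis I x j) y)).det) x z =
      (gramMatrix I g x).det * (metricTrace (g x) (covDerivForm I g nabla x z) +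
        2 * ∑ i, (tangentBasis I x).repr (nabla (extendVec (tangentBasis I x i)) x z) i) := by
  have hg := hs.isRiemannianForm
  have hB (i) := mdifferentiableAt_extendVec (tangentBasis I x i)
  let A : Matrix (Fin (Module.finrank ℝ E)) (Fin (Module.finrank ℝ E)) ℝ := Matrix.of fun k i =>
    (tangentBasis I x).repr (nabla (extendVec (tangentBasis I x i)) x z) k
  let T : Matrix (Fin (Module.finrank ℝ E)) (Fin (Module.finrank ℝ E)) ℝ := Matrix.of fun i j =>
    covDerivForm I g nabla x z (tangentBasis I x i) (tangentBasis I x j)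
  let G := gramMatrix I g x
  have hA (i) : nabla (extendVec (tangentBasis I x i)) x z = ∑ k, A k i • tangentBasis I x k :=
    ((tangentBasis I x).sum_repr _).symm
  have hd : (Matrix.of fun i j => mvfderiv I (fun y => g y (extendVec (tangentBasis I x i) y)
      (extendVec (tangentBasis I x j) y)) x z) = T + (Aᵀ * G + G * A) := by
    ext i j
    have h := hs.covDerivForm_eq (hB i) (hB j) z
    rw [extendVec_self, extendVec_self, hA, hA, metricDeriv] at h
    have h₁ : g x (∑ k, A k i • tangentBasis I x k) (tangentBasis I x j) = (Aᵀ * G) i j := by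
      rw [← hg.toBilin_apply]
      simp only [map_sum, map_smul, LinearMap.sum_apply, LinearMap.smul_apply, smul_eq_mul]
      rfl
    have h₂ : g x (tangentBasis I x i) (∑ k, A k j • tangentBasis I x k) = (G * A) i j := by
      rw [← hg.toBilin_apply, Matrix.mul_apply]
      simp only [map_sum, map_smul, smul_eq_mul, mul_comm]
      rfl
    rw [h₁, h₂] at h
    simp only [Matrix.of_apply, Matrix.add_apply, T]
    linarith
  have hG : (Matrix.of fun i j => g x (extendVec (tangentBasis I x i) x)
      (extendVec (tangentBasis I x j) x)) = G := by
    ext i j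
    simp [extendVec_self, G, gramMatrix]
  have hu := hg.isUnit_det_gramMatrix x
  have hadj : G.adjugate = G.det • G⁻¹ := by
    rw [Matrix.inv_def, smul_smul, Ring.mul_inverse_cancel _ hu, one_smul]
  have htr : (T * G⁻¹).trace = metricTrace (g x) (covDerivForm I g nabla x z) := by
    simp only [Matrix.trace, Matrix.diag, Matrix.mul_apply, metricTrace]
    rw [Finset.sum_comm]
    refine Finset.sum_congr rfl fun i _ => Finset.sum_congr rfl fun j _ => ?_
    rw [mul_comm]
    simp only [T, Matrix.of_apply, hs.covDerivForm_comm x z (tangentBasis I x j)]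
    rfl
  refine (mvfderiv_det_apply (A := fun y => Matrix.of fun i j =>
    g y (extendVec (tangentBasis I x i) y) (extendVec (tangentBasis I x j) y))
    (fun i j => hg.mdifferentiableAt (hB i) (hB j)) z).trans ?_
  rw [hG]
  simp only [Matrix.of_apply]
  rw [hd, hadj, Matrix.mul_smul, Matrix.trace_smul, Matrix.add_mul, Matrix.add_mul,
    Matrix.trace_add, Matrix.trace_add, htr, Matrix.mul_assoc, Matrix.mul_nonsing_inv _ hu,
    Matrix.trace_mul_comm (G * A), ← Matrix.mul_assoc, Matrix.nonsing_inv_mul _ hu, Matrix.mul_one,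
    Matrix.one_mul, Matrix.trace_transpose, smul_eq_mul]
  simp only [Matrix.trace, Matrix.diag, A, Matrix.of_apply]
  ring

end Determinants

section Apolarity

variable {E : Type*} [NormedAddCommGroup E] [NormedSpace ℝ E] [FiniteDimensional ℝ E]
  {H : Type*} [TopologicalSpace H] {I : ModelWithCorners ℝ E H} [I.Boundaryless]
  {M : Type*} [TopologicalSpace M] [ChartedSpace H M] [IsManifold I ∞ M]
  {F : Type*} [NormedAddCommGroup F] [NormedSpace ℝ F]

theorem mvfderiv_clm_comp {G : Type*} [NormedAddCommGroup G] [NormedSpace ℝ G] (L : F →L[ℝ] G)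
    {W : M → F} {x : M} (hW : MDiffAt W x) (v : TangentSpace I x) :
    mvfderiv I (fun y => L (W y)) x v = L (mvfderiv I W x v) := by
  have h := mfderiv_comp x L.differentiableAt.mdifferentiableAt hW
  rw [mfderiv_eq_fderiv, L.fderiv] at h
  exact congrArg (fun A => A v) h

namespace IsTransversalImmersion

variable {f ξ : M → F} (hf : IsTransversalImmersion I f ξ)
include hf

/-- The derivative of `det (f_* B_1, …, f_* B_m, ξ)` for the frame `(B_i)` extending a basis. -/
theorem mvfderiv_det_frame (hθ : ∀ x, transversalForm I f ξ x = 0)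
    (b : Module.Basis (Fin (Module.finrank ℝ E + 1)) ℝ F) (x : M) (z : TangentSpace I x) :
    MDiffAt (fun y => b.det (Fin.snoc (α := fun _ => F)
      (fun i => mvfderiv I f y (extendVec (tangentBasis I x i) y)) (ξ y))) x ∧
    mvfderiv I (fun y => b.det (Fin.snoc (α := fun _ => F)
      (fun i => mvfderiv I f y (extendVec (tangentBasis I x i) y)) (ξ y))) x z =
      b.det (Fin.snoc (α := fun _ => F)
        (fun i => mvfderiv I f x (tangentBasis I x i)) (ξ x)) *
      ∑ i, (tangentBasis I x).repr
        (inducedConn I f ξ (extendVec (tangentBasis I x i)) x z) i := by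
  have : FiniteDimensional ℝ F := Module.Finite.of_basis b
  let w (y : M) : Fin (Module.finrank ℝ E + 1) → F := Fin.snoc (α := fun _ => F)
      (fun i => mvfderiv I f y (extendVec (tangentBasis I x i) y)) (ξ y)
  let dw : Fin (Module.finrank ℝ E + 1) → F := Fin.snoc (α := fun _ => F)
      (fun i => pushDeriv I f (extendVec (tangentBasis I x i)) x z) (mvfderiv I ξ x z)
  let A (k i : Fin (Module.finrank ℝ E)) : ℝ :=
    (tangentBasis I x).repr (inducedConn I f ξ (extendVec (tangentBasis I x i)) x z) k
  let q : Fin (Module.finrank ℝ E + 1) → Fin (Module.finrank ℝ E + 1) → ℝ :=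
    Fin.snoc (α := fun _ => Fin (Module.finrank ℝ E + 1) → ℝ)
      (fun j => Fin.snoc (α := fun _ => ℝ) (fun i => A i j)
        (affineForm I f ξ x z (tangentBasis I x j)))
      (Fin.snoc (α := fun _ => ℝ)
        (fun i => -(tangentBasis I x).repr (shapeOperator I f ξ x z) i) 0)
  let Q : Matrix (Fin (Module.finrank ℝ E + 1)) (Fin (Module.finrank ℝ E + 1)) ℝ :=
    Matrix.of fun k l => q l k
  have hw (l) : MDiffAt (fun y => w y l) x := by
    refine Fin.lastCases ?_ (fun i => ?_) l
    · simpa only [w, Fin.snoc_last] using (hf.smooth_normal x).mdifferentiableAt (by simp)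
    · simpa only [w, Fin.snoc_castSucc] using
        (mdifferentiableAt_extendVec (tangentBasis I x i)).mvfderiv_apply (hf.contMDiffAt_two x)
  have hdw (l) : mvfderiv I (fun y => w y l) x z = dw l := by
    refine Fin.lastCases ?_ (fun i => ?_) l
    · simp only [w, dw, Fin.snoc_last]
    · simp only [w, dw, Fin.snoc_castSucc]
      rfl
  have hwx (l) : w x (Fin.castSucc l) = mvfderiv I f x (tangentBasis I x l) := by
    simp only [w, Fin.snoc_castSucc, extendVec_self]
  have hwl : w x (Fin.last _) = ξ x := by simp only [w, Fin.snoc_last]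
  have hsum (u : TangentSpace I x) : mvfderiv I f x u =
      ∑ i, (tangentBasis I x).repr u i • mvfderiv I f x (tangentBasis I x i) := by
    conv_lhs => rw [← (tangentBasis I x).sum_repr u]
    rw [map_sum]
    simp only [map_smul]
  have hQ (l) : dw l = ∑ k, Q k l • w x k := by
    rw [Fin.sum_univ_castSucc]
    simp only [hwx, hwl, Q, Matrix.of_apply]
    refine Fin.lastCases ?_ (fun j => ?_) l
    · simp only [dw, q, Fin.snoc_last, Fin.snoc_castSucc, neg_smul, Finset.sum_neg_distrib,
        ← hsum]
      rw [hf.mvfderiv_normal, hθ]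
      simp
    · simp only [dw, q, Fin.snoc_last, Fin.snoc_castSucc, A, ← hsum]
      rw [hf.pushDeriv_eq (mdifferentiableAt_extendVec _), extendVec_self]
  have hP (i j) : MDiffAt (fun y => b.toMatrix (w y) i j) x :=
    (b.coord i).toContinuousLinearMap.differentiableAt.mdifferentiableAt.comp x (hw j)
  have hdP : (Matrix.of fun i j => mvfderiv I (fun y => b.toMatrix (w y) i j) x z) =
      b.toMatrix (w x) * Q := by
    rw [← b.toMatrix_mul_of_sum hQ]
    ext i j
    rw [Matrix.of_apply]
    refine (mvfderiv_clm_comp (b.coord i).toContinuousLinearMap (hw j) z).trans ?_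
    rw [hdw]
    rfl
  have htr : Q.trace = ∑ i, A i i := by
    simp [Matrix.trace, Fin.sum_univ_castSucc, Q, q]
  have hx : b.det (w x) = b.det (Fin.snoc (α := fun _ => F)
      (fun i => mvfderiv I f x (tangentBasis I x i)) (ξ x)) := by
    simp only [w, extendVec_self]
  rw [← hx]
  refine ⟨mdifferentiableAt_det hP, ?_⟩
  refine (mvfderiv_det_apply (A := fun y => b.toMatrix (w y)) hP z).trans ?_
  rw [hdP, Matrix.trace_mul_comm, ← Matrix.mul_assoc, Matrix.adjugate_mul, Matrix.smul_mul,
    Matrix.one_mul, Matrix.trace_smul, htr, smul_eq_mul, b.det_apply]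

/-- Apolarity: the cubic form of an immersion whose induced volume form is the volume form of the
affine metric is trace-free. -/
theorem metricTrace_covDerivForm_eq_zero (hθ : ∀ x, transversalForm I f ξ x = 0)
    (hpos : ∀ x v, v ≠ 0 → 0 < affineForm I f ξ x v v) {n : ℕ} (hn : Module.finrank ℝ E = n)
    (b : Module.Basis (Fin (n + 1)) ℝ F)
    (hvol : ∀ (x : M) (X : Fin n → TangentSpace I x),
      |b.det (Fin.snoc (α := fun _ => F) (fun i => mvfderiv I f x (X i)) (ξ x))| =
        Real.sqrt (Matrix.of fun i j => affineForm I f ξ x (X i) (X j)).det)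
    (x : M) (z : TangentSpace I x) :
    metricTrace (affineForm I f ξ x)
      (covDerivForm I (affineForm I f ξ) (inducedConn I f ξ) x z) = 0 := by
  subst hn
  have hs := hf.isStatisticalStructure hθ hpos
  have hg := hs.isRiemannianForm
  let D (y : M) : ℝ := b.det (Fin.snoc (α := fun _ => F)
      (fun i => mvfderiv I f y (extendVec (tangentBasis I x i) y)) (ξ y))
  have hsq (y : M) : (Matrix.of fun i j => affineForm I f ξ y (extendVec (tangentBasis I x i) y)
      (extendVec (tangentBasis I x j) y)).det = D y ^ 2 := by
    rw [← sq_abs, hvol, Real.sq_sqrt (hg.det_nonneg _)]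
  have hDx : D x = b.det (Fin.snoc (α := fun _ => F)
      (fun i => mvfderiv I f x (tangentBasis I x i)) (ξ x)) := by
    simp only [D, extendVec_self]
  have hGx : (gramMatrix I (affineForm I f ξ) x).det = D x ^ 2 := by
    rw [← hsq]
    simp only [extendVec_self]
    rfl
  have h₁ := hs.mvfderiv_det_gramMatrix x z
  obtain ⟨hDd, h₂⟩ := hf.mvfderiv_det_frame hθ b x z
  have hu := (hg.isUnit_det_gramMatrix x).ne_zero
  rw [hGx] at hu h₁
  rw [← hDx] at h₂
  have hD0 : D x ≠ 0 := fun h => hu (by rw [h]; simp)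
  change MDiffAt D x at hDd
  have h₃ : mvfderiv I (fun y => D y ^ 2) x z = 2 * D x * mvfderiv I D x z := by
    have h := mvfderiv_smul_apply hDd hDd z
    simp only [smul_eq_mul, ← pow_two] at h
    rw [h]
    ring
  simp only [hsq] at h₁
  rw [h₃] at h₁
  change mvfderiv I D x z = _ at h₂
  rw [h₂] at h₁
  have h₄ : D x ^ 2 * metricTrace (affineForm I f ξ x)
      (covDerivForm I (affineForm I f ξ) (inducedConn I f ξ) x z) = 0 := by
    linear_combination -h₁
  exact (mul_eq_zero.1 h₄).resolve_left hu

end IsTransversalImmersion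

end Apolarity

section EuclideanTarget

variable {n : ℕ}

/-- The constant vector fields of `ℝⁿ`. -/
def constField {x : EuclideanSpace ℝ (Fin n)}
    (v : TangentSpace 𝓘(ℝ, EuclideanSpace ℝ (Fin n)) x) (y : EuclideanSpace ℝ (Fin n)) :
    TangentSpace 𝓘(ℝ, EuclideanSpace ℝ (Fin n)) y := v

theorem extendVec_eq_constField {x : EuclideanSpace ℝ (Fin n)}
    (v : TangentSpace 𝓘(ℝ, EuclideanSpace ℝ (Fin n)) x) : extendVec v = constField v := by
  funext y
  rw [extendVec_eq_symmL v (by rw [chartAt_self_eq]; exact Set.mem_univ y),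
    TangentBundle.symmL_model_space, TangentBundle.continuousLinearMapAt_model_space]
  rfl

theorem metricSharp_zero {E : Type*} [NormedAddCommGroup E] [NormedSpace ℝ E]
    [FiniteDimensional ℝ E] {H : Type*} [TopologicalSpace H] {I : ModelWithCorners ℝ E H}
    {M : Type*} [TopologicalSpace M] [ChartedSpace H M] [IsManifold I ∞ M] {x : M}
    (g : TangentSpace I x → TangentSpace I x → ℝ) : metricSharp g (fun _ => 0) = 0 := by
  simp [metricSharp, metricTrace]

theorem metricDeriv_constField {p q : EuclideanSpace ℝ (Fin n)} (v : TangentSpace 𝓘(ℝ, EuclideanSpace ℝ (Fin n)) p)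
    (w : TangentSpace 𝓘(ℝ, EuclideanSpace ℝ (Fin n)) q) (x : EuclideanSpace ℝ (Fin n)) (u : TangentSpace 𝓘(ℝ, EuclideanSpace ℝ (Fin n)) x) :
    metricDeriv (euclideanMetric n) (constField v) (constField w) x u = 0 :=
  congrArg (fun L => L u) (mvfderiv_const (euclideanMetric n x (constField v x) (constField w x)))

theorem flatConn_constField {p : EuclideanSpace ℝ (Fin n)} (v : TangentSpace 𝓘(ℝ, EuclideanSpace ℝ (Fin n)) p)
    (x : EuclideanSpace ℝ (Fin n)) : flatConn n (constField v) x = 0 :=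
  fderiv_const_apply (𝕜 := ℝ) (E := EuclideanSpace ℝ (Fin n)) (F := EuclideanSpace ℝ (Fin n)) (x := x) v

theorem mlieBracket_constField {p q : EuclideanSpace ℝ (Fin n)} (v : TangentSpace 𝓘(ℝ, EuclideanSpace ℝ (Fin n)) p)
    (w : TangentSpace 𝓘(ℝ, EuclideanSpace ℝ (Fin n)) q) (x : EuclideanSpace ℝ (Fin n)) :
    VectorField.mlieBracket 𝓘(ℝ, EuclideanSpace ℝ (Fin n)) (constField v) (constField w) x =
      0 := by
  have h := mlieBracket_extendVec (I := 𝓘(ℝ, EuclideanSpace ℝ (Fin n))) (x := x)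
    (constField v x) (constField w x)
  rw [extendVec_eq_constField, extendVec_eq_constField] at h
  exact h

theorem euclideanMetric_zero_left (x : EuclideanSpace ℝ (Fin n))
    (v : TangentSpace 𝓘(ℝ, EuclideanSpace ℝ (Fin n)) x) : euclideanMetric n x 0 v = 0 :=
  inner_zero_left (𝕜 := ℝ) (E := EuclideanSpace ℝ (Fin n)) _

theorem conjugateConn_flatConn_constField {p : EuclideanSpace ℝ (Fin n)} (v : TangentSpace 𝓘(ℝ, EuclideanSpace ℝ (Fin n)) p)
    (x : EuclideanSpace ℝ (Fin n)) :
    conjugateConn (euclideanMetric n) (flatConn n) (constField v) x = 0 := by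
  ext1 u
  have h (u) : (metricSharp (euclideanMetric n x) fun w =>
      metricDeriv (euclideanMetric n) (extendVec w) (constField v) x u -
        euclideanMetric n x (flatConn n (extendVec w) x u) (constField v x)) = 0 := by
    simp only [extendVec_eq_constField, flatConn_constField, _root_.zero_apply,
      euclideanMetric_zero_left, metricDeriv_constField, sub_zero, metricSharp_zero]
  exact (linearize_apply 0 h u).trans (h u)

theorem leviCivita_constField {p : EuclideanSpace ℝ (Fin n)} (v : TangentSpace 𝓘(ℝ, EuclideanSpace ℝ (Fin n)) p)
    (x : EuclideanSpace ℝ (Fin n)) :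
    leviCivita (euclideanMetric n) (constField v) x = 0 := by
  ext1 u
  have h (u) : (metricSharp (euclideanMetric n x) fun w => (1 / 2 : ℝ) *
      (metricDeriv (euclideanMetric n) (constField v) (extendVec w) x u
        + metricDeriv (euclideanMetric n) (extendVec u) (extendVec w) x (constField v x)
        - metricDeriv (euclideanMetric n) (extendVec u) (constField v) x w
        + euclideanMetric n x (VectorField.mlieBracket 𝓘(ℝ, EuclideanSpace ℝ (Fin n))
            (extendVec u) (constField v) x) w
        - euclideanMetric n x (VectorField.mlieBracket 𝓘(ℝ, EuclideanSpace ℝ (Fin n))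
            (extendVec u) (extendVec w) x) (constField v x)
        - euclideanMetric n x (VectorField.mlieBracket 𝓘(ℝ, EuclideanSpace ℝ (Fin n))
            (constField v) (extendVec w) x) u)) = 0 := by
    simp only [extendVec_eq_constField, mlieBracket_constField, euclideanMetric_zero_left,
      metricDeriv_constField, sub_zero, add_zero, mul_zero, metricSharp_zero]
  exact (linearize_apply 0 h u).trans (h u)

theorem differenceTensor_flatConn (x : EuclideanSpace ℝ (Fin n))
    (v w : TangentSpace 𝓘(ℝ, EuclideanSpace ℝ (Fin n)) x) :
    differenceTensor (euclideanMetric n) (flatConn n) x v w = 0 := by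
  rw [differenceTensor, extendVec_eq_constField, flatConn_constField, leviCivita_constField]
  exact sub_zero _

theorem curvature_flatConn (x : EuclideanSpace ℝ (Fin n))
    (u v w : TangentSpace 𝓘(ℝ, EuclideanSpace ℝ (Fin n)) x) :
    curvature (flatConn n) x u v w = 0 := by
  have h : flatConn n (fun _ => 0) x = 0 := flatConn_constField (p := x) 0 x
  simp only [curvature, extendVec_eq_constField, flatConn_constField, _root_.zero_apply, h,
    sub_zero]

theorem curvatureInterchange_flatConn (x : EuclideanSpace ℝ (Fin n))
    (u v w : TangentSpace 𝓘(ℝ, EuclideanSpace ℝ (Fin n)) x) :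
    curvatureInterchange (euclideanMetric n) (flatConn n) x u v w = 0 := by
  simp only [curvatureInterchange, curvature_flatConn, euclideanMetric_zero_left, metricSharp_zero]

variable {E : Type*} [NormedAddCommGroup E] [NormedSpace ℝ E] [FiniteDimensional ℝ E]
  {H : Type*} [TopologicalSpace H] {I : ModelWithCorners ℝ E H}
  {M : Type*} [TopologicalSpace M] [ChartedSpace H M] [IsManifold I ∞ M]

/-- A connection of `ℝⁿ` that kills the constant vector fields induces the usual derivative of
vector-valued functions. -/
theorem pullbackConn_eq_mvfderiv {nabla : AffineConn 𝓘(ℝ, EuclideanSpace ℝ (Fin n))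
      (EuclideanSpace ℝ (Fin n))}
    (h : ∀ {p : EuclideanSpace ℝ (Fin n)} (v : TangentSpace 𝓘(ℝ, EuclideanSpace ℝ (Fin n)) p) (x : EuclideanSpace ℝ (Fin n)),
      nabla (constField v) x = 0)
    (u U : M → EuclideanSpace ℝ (Fin n)) (x : M) (v : TangentSpace I x) :
    pullbackConn u nabla U x v = mvfderiv I U x v := by
  have h₁ : nabla (fun q => (trivializationAt (EuclideanSpace ℝ (Fin n))
      (TangentSpace 𝓘(ℝ, EuclideanSpace ℝ (Fin n)) : EuclideanSpace ℝ (Fin n) → Type _)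
      (u x)).symmL ℝ q ((trivializationAt (EuclideanSpace ℝ (Fin n))
      (TangentSpace 𝓘(ℝ, EuclideanSpace ℝ (Fin n)) : EuclideanSpace ℝ (Fin n) → Type _)
      (u x)).continuousLinearMapAt ℝ (u x) (U x))) (u x) = 0 := by
    refine Eq.trans ?_ (h (p := u x) (U x) (u x))
    congr 1
    funext q
    rw [TangentBundle.symmL_model_space, TangentBundle.continuousLinearMapAt_model_space]
    rfl
  simp only [pullbackConn]
  rw [h₁]
  rw [ContinuousLinearMap.zero_comp, add_zero, TangentBundle.symmL_model_space]
  simp only [TangentBundle.continuousLinearMapAt_model_space]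
  rfl

end EuclideanTarget

section BiTension

variable {E : Type*} [NormedAddCommGroup E] [NormedSpace ℝ E] [FiniteDimensional ℝ E]
  {H : Type*} [TopologicalSpace H] {I : ModelWithCorners ℝ E H} [I.Boundaryless]
  {M : Type*} [TopologicalSpace M] [ChartedSpace H M] [IsManifold I ∞ M] {n : ℕ}

namespace IsTransversalImmersion

variable {f ξ : M → EuclideanSpace ℝ (Fin n)} (hf : IsTransversalImmersion I f ξ)
include hf

theorem tension_eq
    (hg : IsRiemannianForm I (affineForm I f ξ)) (x : M) :
    tension (affineForm I f ξ) (inducedConn I f ξ) (flatConn n) f x =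
      (Module.finrank ℝ E : ℝ) • ξ x := by
  have h (v w : TangentSpace I x) : pullbackConn f (flatConn n)
      (fun y => mfderiv I 𝓘(ℝ, EuclideanSpace ℝ (Fin n)) f y (extendVec w y)) x v -
        mfderiv I 𝓘(ℝ, EuclideanSpace ℝ (Fin n)) f x (inducedConn I f ξ (extendVec w) x v) =
      affineForm I f ξ x v w • ξ x := by
    have h₁ := hf.pushDeriv_eq (mdifferentiableAt_extendVec w) v
    rw [extendVec_self] at h₁
    exact (congrArg
      (fun a : EuclideanSpace ℝ (Fin n) => a - mvfderiv I f x (inducedConn I f ξ (extendVec w) x v))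
      (pullbackConn_eq_mvfderiv flatConn_constField f _ x v)).trans (sub_eq_of_eq_add' h₁)
  refine (congrArg (metricTrace (affineForm I f ξ x))
    (funext fun v => funext fun w => h v w)).trans ?_
  refine (metricTrace_smul_const (W := EuclideanSpace ℝ (Fin n)) (affineForm I f ξ x) (ξ x)).trans ?_
  rw [hg.metricTrace_self]

theorem mdifferentiableAt_shapeOperator {Y : (x : M) → TangentSpace I x} {x : M}
    (hY : MDiffAt (T% Y) x) : MDiffAt (T% (fun y => shapeOperator I f ξ y (Y y))) x :=
  mdifferentiableAt_neg_section (hf.mdifferentiableAt_tangentPart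
    (hY.mvfderiv_apply ((hf.smooth_normal x).of_le two_le_infty)))

theorem mvfderiv_smul_normal (hθ : ∀ x, transversalForm I f ξ x = 0) (c : ℝ) (x : M)
    (v : TangentSpace I x) :
    mvfderiv I (fun y => c • ξ y) x v = -c • mvfderiv I f x (shapeOperator I f ξ x v) := by
  have h := mvfderiv_clm_comp (c • ContinuousLinearMap.id ℝ (EuclideanSpace ℝ (Fin n)))
    ((hf.smooth_normal x).mdifferentiableAt (by simp)) v
  refine h.trans ?_
  rw [hf.mvfderiv_normal, hθ]
  simp

theorem statLaplacian_smul_normal (hθ : ∀ x, transversalForm I f ξ x = 0)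
    (hs : IsStatisticalStructure I (affineForm I f ξ) (inducedConn I f ξ))
    (hap : ∀ x z, metricTrace (affineForm I f ξ x)
      (covDerivForm I (affineForm I f ξ) (inducedConn I f ξ) x z) = 0) (c : ℝ) (x : M) :
    statLaplacian (V := fun y => TangentSpace 𝓘(ℝ, EuclideanSpace ℝ (Fin n)) (f y))
        (affineForm I f ξ) (conjugateConn (affineForm I f ξ) (inducedConn I f ξ))
        (pullbackConn f (conjugateConn (euclideanMetric n) (flatConn n)))
        (fun y => c • ξ y) x =
      -c • (mvfderiv I f x (metricTrace (affineForm I f ξ x)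
        (covDerivEnd (inducedConn I f ξ) (shapeOperator I f ξ) x)) +
        LinearMap.trace ℝ (TangentSpace I x) (shapeOperator I f ξ x).toLinearMap • ξ x) := by
  let C := IsStatisticalStructure.cubicSharp I (affineForm I f ξ) (inducedConn I f ξ) hs x
  let S := shapeOperator I f ξ
  have hp (U : M → EuclideanSpace ℝ (Fin n)) (y : M) (v : TangentSpace I y) :
      pullbackConn f (conjugateConn (euclideanMetric n) (flatConn n)) U y v = mvfderiv I U y v :=
    pullbackConn_eq_mvfderiv conjugateConn_flatConn_constField f U y v
  have hB (v w : TangentSpace I x) :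
      mvfderiv I (fun y => mvfderiv I (fun y => c • ξ y) y (extendVec w y)) x v -
        mvfderiv I (fun y => c • ξ y) x
          (conjugateConn (affineForm I f ξ) (inducedConn I f ξ) (extendVec w) x v) =
      -c • ((mvfderiv I f x (covDerivEnd (inducedConn I f ξ) S x v w) +
        affineForm I f ξ x v (S x w) • ξ x) + (-mvfderiv I f x ∘L S x) (C v w)) := by
    have hY := hf.mdifferentiableAt_shapeOperator (mdifferentiableAt_extendVec w)
    have h₁ := mvfderiv_clm_comp (-c • ContinuousLinearMap.id ℝ (EuclideanSpace ℝ (Fin n)))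
      (hY.mvfderiv_apply (hf.contMDiffAt_two x)) v
    have h₂ := hf.pushDeriv_eq hY v
    have h₃ (y) (u : TangentSpace I y) := hf.mvfderiv_smul_normal hθ c y u
    have h₄ := hs.conjugateConn_apply (mdifferentiableAt_extendVec w) v
    rw [extendVec_self] at h₂ h₄
    rw [h₃, h₄, funext fun y => h₃ y (extendVec w y)]
    refine (congrArg (fun a : EuclideanSpace ℝ (Fin n) => a - _) (h₁.trans (congrArg _ h₂))).trans ?_
    simp only [covDerivEnd, map_sub, map_add, ContinuousLinearMap.comp_apply, _root_.neg_apply,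
      _root_.smul_apply, ContinuousLinearMap.id_apply, smul_add, smul_sub, smul_neg, C, S]
    abel
  have hC : metricTrace (affineForm I f ξ x) (fun v w => C v w) = 0 :=
    hs.metricTrace_cubicSharp (hap x)
  have hT : (metricTrace (affineForm I f ξ x) fun v w =>
      -c • ((mvfderiv I f x (covDerivEnd (inducedConn I f ξ) S x v w) +
        affineForm I f ξ x v (S x w) • ξ x) + (-mvfderiv I f x ∘L S x) (C v w))) =
      -c • (mvfderiv I f x (metricTrace (affineForm I f ξ x)
        (covDerivEnd (inducedConn I f ξ) S x)) +
        LinearMap.trace ℝ (TangentSpace I x) (S x).toLinearMap • ξ x) := by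
    rw [metricTrace_smul, metricTrace_add, metricTrace_add, metricTrace_smul_const]
    have h₁ := metricTrace_linearMap (g := affineForm I f ξ x) (mvfderiv I f x).toLinearMap
      (covDerivEnd (inducedConn I f ξ) S x)
    have h₂ := metricTrace_linearMap (g := affineForm I f ξ x)
      (-mvfderiv I f x ∘L S x).toLinearMap (fun v w => C v w)
    have h₃ := hs.isRiemannianForm.metricTrace_endomorphism x (S x).toLinearMap
    rw [hC, map_zero] at h₂
    refine congrArg (fun a => -c • a) ?_
    refine (congrArg₂ (· + ·) (congrArg₂ (· + ·) h₁ (congrArg (· • ξ x) h₃)) h₂).trans ?_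
    simp
  refine Eq.trans (congrArg (metricTrace (affineForm I f ξ x))
    (funext fun v => funext fun w => ?_)) hT
  refine Eq.trans ?_ (hB v w)
  refine congrArg₂ (fun a b : EuclideanSpace ℝ (Fin n) => a - b) ?_ (hp _ x _)
  refine (hp _ x v).trans ?_
  exact congrArg (fun U : M → EuclideanSpace ℝ (Fin n) => mvfderiv I U x v)
    (funext fun y => hp _ y (extendVec w y))

theorem biTension_eq (hθ : ∀ x, transversalForm I f ξ x = 0)
    (hs : IsStatisticalStructure I (affineForm I f ξ) (inducedConn I f ξ))
    (hap : ∀ x z, metricTrace (affineForm I f ξ x)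
      (covDerivForm I (affineForm I f ξ) (inducedConn I f ξ) x z) = 0) (x : M) :
    biTension (affineForm I f ξ) (inducedConn I f ξ) (euclideanMetric n) (flatConn n) f x =
      -(Module.finrank ℝ E : ℝ) • (mvfderiv I f x (metricTrace (affineForm I f ξ x)
        (covDerivEnd (inducedConn I f ξ) (shapeOperator I f ξ) x)) +
        LinearMap.trace ℝ (TangentSpace I x) (shapeOperator I f ξ x).toLinearMap • ξ x) := by
  have h₁ : tension (affineForm I f ξ) (inducedConn I f ξ) (flatConn n) f =
      fun x => (Module.finrank ℝ E : ℝ) • ξ x := funext (hf.tension_eq hs.isRiemannianForm)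
  have h₂ : traceK (affineForm I f ξ) (inducedConn I f ξ) = fun _ => 0 :=
    funext fun y => hs.traceK_eq_zero (hap y)
  have h₃ := hf.statLaplacian_smul_normal hθ hs hap (Module.finrank ℝ E) x
  have h₄ : (metricTrace (affineForm I f ξ x) fun _ _ => (0 : EuclideanSpace ℝ (Fin n))) = 0 := by
    simp [metricTrace]
  have h₅ : (metricTrace (affineForm I f ξ x) fun v w =>
      curvatureInterchange (euclideanMetric n) (flatConn n) (f x)
        (mfderiv I 𝓘(ℝ, EuclideanSpace ℝ (Fin n)) f x v)
        (tension (affineForm I f ξ) (inducedConn I f ξ) (flatConn n) f x)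
        (mfderiv I 𝓘(ℝ, EuclideanSpace ℝ (Fin n)) f x w)) = 0 := by
    simp only [curvatureInterchange_flatConn]
    exact h₄
  rw [biTension, h₅, differenceTensor_flatConn, h₂, hs.metricDiv_zero, zero_smul, add_zero,
    sub_zero, sub_zero, h₁]
  exact h₃

end IsTransversalImmersion

end BiTension

theorem IsBlaschkeHypersurface.isTransversalImmersion {m : ℕ} {M : Type*} [TopologicalSpace M]
    [ChartedSpace (EuclideanSpace ℝ (Fin m)) M] [IsManifold (𝓡 m) ∞ M]
    {f ξ : M → EuclideanSpace ℝ (Fin (m + 1))} (hf : IsBlaschkeHypersurface f ξ) :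
    IsTransversalImmersion (𝓡 m) f ξ := by
  refine ⟨hf.smooth, hf.smooth_normal, fun x => ?_⟩
  have : FiniteDimensional ℝ (TangentSpace (𝓡 m) x) :=
    inferInstanceAs (FiniteDimensional ℝ (EuclideanSpace ℝ (Fin m)))
  have : T2Space (TangentSpace (𝓡 m) x) := inferInstanceAs (T2Space (EuclideanSpace ℝ (Fin m)))
  have hdim : Module.finrank ℝ (TangentSpace (𝓡 m) x) = m :=
    finrank_euclideanSpace_fin (𝕜 := ℝ) (n := m)
  have hξ : ξ x ≠ 0 := by
    intro h
    have hr := Submodule.finrank_add_eq_of_isCompl (hf.transversal x)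
    have hle := LinearMap.finrank_range_le (mvfderiv (𝓡 m) f x).toLinearMap
    have hr' : Module.finrank ℝ (mvfderiv (𝓡 m) f x).range + Module.finrank ℝ
        (Submodule.span ℝ {ξ x}) = m + 1 := hr.trans finrank_euclideanSpace_fin
    rw [h, Submodule.span_zero_singleton, finrank_bot] at hr'
    have hle' : Module.finrank ℝ (mvfderiv (𝓡 m) f x).range ≤ m := hle.trans_eq hdim
    omega
  have hinj : Function.Injective (splitMap (𝓡 m) f ξ x).toLinearMap := by
    rw [← LinearMap.ker_eq_bot, LinearMap.ker_eq_bot']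
    rintro ⟨v, t⟩ h
    have h' : mvfderiv (𝓡 m) f x v + t • ξ x = 0 := by simpa [splitMap] using h
    have hv : mvfderiv (𝓡 m) f x v = -(t • ξ x) := eq_neg_of_add_eq_zero_left h'
    have h0 : mvfderiv (𝓡 m) f x v = 0 :=
      (Submodule.disjoint_def.1 (hf.transversal x).disjoint) _ ⟨v, rfl⟩
        (hv ▸ neg_mem (Submodule.smul_mem _ _ (Submodule.mem_span_singleton_self _)))
    have ht : t = 0 := by
      rw [h0, zero_add] at h'
      exact (smul_eq_zero.1 h').resolve_right hξ
    have hv0 : v = 0 := hf.immersion x (h0.trans (map_zero _).symm)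
    rw [hv0, ht]
    rfl
  have hd : Module.finrank ℝ (TangentSpace (𝓡 m) x × ℝ) =
      Module.finrank ℝ (EuclideanSpace ℝ (Fin (m + 1))) := by
    rw [Module.finrank_prod, hdim, Module.finrank_self, finrank_euclideanSpace_fin]
  refine ⟨(LinearEquiv.ofInjectiveOfFinrankEq (splitMap (𝓡 m) f ξ x).toLinearMap hinj
    hd).toContinuousLinearEquiv, ?_⟩
  exact ContinuousLinearMap.ext fun p => rfl

theorem mainTheorem2 {m : ℕ} (hm : 2 ≤ m)
    {M : Type*} [TopologicalSpace M] [T2Space M] [SecondCountableTopology M]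
    [ChartedSpace (EuclideanSpace ℝ (Fin m)) M] [IsManifold (𝓡 m) ∞ M]
    (f ξ : M → EuclideanSpace ℝ (Fin (m + 1))) (hf : IsBlaschkeHypersurface f ξ) :
    IsStatisticalStructure (𝓡 m) (affineForm (𝓡 m) f ξ) (inducedConn (𝓡 m) f ξ) ∧
    (∀ x, tension (affineForm (𝓡 m) f ξ) (inducedConn (𝓡 m) f ξ) (flatConn (m + 1)) f x
        = (m : ℝ) • ξ x) ∧
    (∀ x, tension (affineForm (𝓡 m) f ξ) (inducedConn (𝓡 m) f ξ) (flatConn (m + 1)) f x ≠ 0) ∧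
    (IsStatisticalBiharmonic (affineForm (𝓡 m) f ξ) (inducedConn (𝓡 m) f ξ)
        (euclideanMetric (m + 1)) (flatConn (m + 1)) f ↔
      (∀ x, LinearMap.trace ℝ (TangentSpace (𝓡 m) x)
          (shapeOperator (𝓡 m) f ξ x).toLinearMap = 0) ∧
      (∀ x, metricTrace (affineForm (𝓡 m) f ξ x)
          (covDerivEnd (inducedConn (𝓡 m) f ξ) (shapeOperator (𝓡 m) f ξ) x) = 0)) ∧
    ((∀ x, shapeOperator (𝓡 m) f ξ x = 0) →
      IsStatisticalBiharmonic (affineForm (𝓡 m) f ξ) (inducedConn (𝓡 m) f ξ)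
        (euclideanMetric (m + 1)) (flatConn (m + 1)) f) := by
  have ht := hf.isTransversalImmersion
  have hs := ht.isStatisticalStructure hf.equiaffine hf.posDef
  have hap := ht.metricTrace_covDerivForm_eq_zero hf.equiaffine hf.posDef
    (finrank_euclideanSpace_fin (𝕜 := ℝ) (n := m)) _ hf.volume
  have hm0 : (m : ℝ) ≠ 0 := by
    have : m ≠ 0 := by omega
    exact_mod_cast this
  have hτ (x) := ht.tension_eq hs.isRiemannianForm x
  have hτ₂ (x) := ht.biTension_eq hf.equiaffine hs hap x
  simp only [finrank_euclideanSpace_fin] at hτ hτ₂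
  have hiff : IsStatisticalBiharmonic (affineForm (𝓡 m) f ξ) (inducedConn (𝓡 m) f ξ)
        (euclideanMetric (m + 1)) (flatConn (m + 1)) f ↔
      (∀ x, LinearMap.trace ℝ (TangentSpace (𝓡 m) x)
          (shapeOperator (𝓡 m) f ξ x).toLinearMap = 0) ∧
      (∀ x, metricTrace (affineForm (𝓡 m) f ξ x)
          (covDerivEnd (inducedConn (𝓡 m) f ξ) (shapeOperator (𝓡 m) f ξ) x) = 0) := by
    refine ⟨fun h => ?_, fun h x => ?_⟩
    · have key (x) := ht.mvfderiv_add_smul_eq_zero ((smul_eq_zero.1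
        ((hτ₂ x).symm.trans (h x))).resolve_left (neg_ne_zero.2 hm0))
      exact ⟨fun x => (key x).2, fun x => (key x).1⟩
    · refine (hτ₂ x).trans ?_
      rw [h.1, h.2, map_zero, zero_smul, add_zero, smul_zero]
      rfl
  refine ⟨hs, hτ, fun x h => ?_, hiff, fun hS => hiff.2 ⟨fun x => ?_, fun x => ?_⟩⟩
  · have h₁ := (smul_eq_zero.1 ((hτ x).symm.trans h)).resolve_left hm0
    have h₂ := ht.mvfderiv_add_smul_eq_zero (x := x) (v := 0) (s := 1)
      (by rw [map_zero, zero_add, one_smul]; exact h₁)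
    exact one_ne_zero h₂.2
  · rw [hS]
    exact map_zero _
  · have h (v w : TangentSpace (𝓡 m) x) :
        covDerivEnd (inducedConn (𝓡 m) f ξ) (shapeOperator (𝓡 m) f ξ) x v w = 0 := by
      have h₀ : inducedConn (𝓡 m) f ξ (fun y => shapeOperator (𝓡 m) f ξ y (extendVec w y)) x = 0 := by
        simp only [hS, _root_.zero_apply]
        exact ht.isCovariantDerivativeOn_inducedConn.zero
      rw [covDerivEnd, h₀, hS]
      exact sub_zero _
    rw [funext fun v => funext fun w => h v w]
    simp [metricTrace]
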